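/- Let $T>0$, $d\ge 0$ an integer, $S^1=\mathbf R/\mathbf Z$ identified with $[0,1]$, and let $\tilde p_t(x)=\sum_{n\in\mathbf Z}(4\pi t)^{-1/2}e^{-(x+n)^2/(4t)}$ be the heat kernel of $S^1$. Let $\xi^1,\dots,\xi^d$ be independent space-time white noises on $[0,T]\times S^1$ and let $\psi=(\psi(t,x))_{0\le t\le T,\,0\le x\le 1}$ be the solution of the $\mathbf R^d$-valued stochastic heat equation $\partial_t\psi=\partial_x^2\psi+\xi$, $\psi(0,\cdot)\equiv 0$, that is, $\psi^i(t,x)=\int_0^t\int_0^1\tilde p_{t-s}(x-y)\,\xi^i(ds,dy)$ for $1\le i\le d$. For a Banach space $\mathcal V$, $S>0$, $\gamma\in(0,1]$ and real $m\ge 1$, let $C^{B;\gamma,m}([0,S],\mathcal V)$ be the space of continuous $f:[0,S]\to\mathcal V$ with $\|f\|=|f_0|+\bigl(\iint_{0\le s\le t\le S}|f_t-f_s|^m|t-s|^{-1-\gamma m}\,ds\,dt\bigr)^{1/m}<\infty$, and let $C_0^{B;\gamma,m}$ be its subspace of paths with $f_0=0$. Let $\alpha\in(1/3,1/2)$, $\beta>0$,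 $m\ge1$ satisfy $\alpha-1/m>1/3$, $\beta>1/m$, $4\beta<1-2\alpha$. Let $\mu$ be the law of $\psi$, a centred Gaussian measure on $E=C_0^{B;\beta,m}\bigl([0,T],C^{B;\alpha,m}([0,1],\mathbf R^d)\bigr)$, and let $\mathcal H$ be its Cameron–Martin space, $\|h\|_{\mathcal H}=\sup\{\ell(h):\ell\in E^*,\ \mathrm{Var}_\mu(\ell)\le 1\}$, $\mathcal H=\{h\in E:\|h\|_{\mathcal H}<\infty\}$. (i) There is a constant $c=c_T>0$ such that for all $h\in\mathcal H$ and all $t\in[0,T]$ the path $h(t,\cdot)$ is $1/2$-Hölder continuous and $$|h(t,0)|+\sup_{0\le x<y\le1}\frac{|h(t,y)-h(t,x)|}{|y-x|^{1/2}}\le c\,\|h\|_{\mathcal H}.$$ (ii) For every $q\in(4/3,2)$ there is a constant $c=c_{T,q}>0$ such that for all $h\in\mathcal H$ and all $t\in[0,T]$ the path $h(t,\cdot)$ has finite $q$-variation and $$\Bigl(\sup_{0\le x_0\le\dots\le x_n\le1}\ \sum_{i=1}^{n}|h(t,x_i)-h(t,x_{i-1})|^q\Bigr)^{1/q}\le c\,\|h\|_{\mathcal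 H}.$$ The constants depend only on $T$, respectively on $T$ and $q$. -/

import Mathlib

open MeasureTheory ProbabilityTheory
open scoped ENNReal NNReal

noncomputable section

/-! ### Besov path spaces -/

namespace BesovPath

/-- Lebesgue measure on `[0, T]`, as a measure on the subtype. -/
def timeMeasure (T : ℝ) : Measure (Set.Icc (0 : ℝ) T) := volume.comap Subtype.val

instance (T : ℝ) : IsFiniteMeasure (timeMeasure T) := by
  refine ⟨?_⟩
  rw [timeMeasure, comap_subtype_coe_apply measurableSet_Icc, Set.image_univ, Subtype.range_coe]
  exact measure_Icc_lt_top

/-- The Besov seminorm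
`(∬_{0 ≤ s ≤ t ≤ T} |f_t - f_s|^m / |t - s|^(1 + α m) ds dt)^(1/m)` of a continuous path. -/
def seminorm {T : ℝ} (α m : ℝ) {V : Type*} [NormedAddCommGroup V]
    (f : C(Set.Icc (0 : ℝ) T, V)) : ℝ≥0∞ :=
  (∫⁻ p in {p : Set.Icc (0 : ℝ) T × Set.Icc (0 : ℝ) T | p.1 ≤ p.2},
    ‖f p.2 - f p.1‖ₑ ^ m / ENNReal.ofReal (|(p.2 : ℝ) - (p.1 : ℝ)| ^ (1 + α * m))
      ∂((timeMeasure T).prod (timeMeasure T))) ^ (1 / m)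

section Lemmas

variable {T : ℝ} {α m : ℝ} {V : Type*} [NormedAddCommGroup V]

/-- The quotient whose `L^m` norm over the simplex is the Besov seminorm. -/
def quot (α m : ℝ) (f : C(Set.Icc (0 : ℝ) T, V))
    (p : Set.Icc (0 : ℝ) T × Set.Icc (0 : ℝ) T) : ℝ≥0∞ :=
  ‖f p.2 - f p.1‖ₑ / ENNReal.ofReal (|(p.2 : ℝ) - (p.1 : ℝ)| ^ (1 + α * m)) ^ (1 / m)

lemma measurable_quot (f : C(Set.Icc (0 : ℝ) T, V)) : Measurable (quot α m f) := by
  unfold quot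
  refine Measurable.div (Continuous.measurable (by fun_prop)) ?_
  refine Measurable.pow_const (Measurable.ennreal_ofReal (Measurable.pow_const ?_ _)) _
  exact Continuous.measurable (by fun_prop)

lemma seminorm_eq (hm : 1 ≤ m) (f : C(Set.Icc (0 : ℝ) T, V)) :
    seminorm α m f =
      (∫⁻ p in {p : Set.Icc (0 : ℝ) T × Set.Icc (0 : ℝ) T | p.1 ≤ p.2},
        quot α m f p ^ m ∂((timeMeasure T).prod (timeMeasure T))) ^ (1 / m) := by
  have hm0 : 0 < m := by linarith
  unfold seminorm quot
  congr 2
  funext p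
  rw [ENNReal.div_rpow_of_nonneg _ _ hm0.le, ← ENNReal.rpow_mul, one_div,
    inv_mul_cancel₀ hm0.ne', ENNReal.rpow_one]

lemma seminorm_zero (hm : 1 ≤ m) : seminorm α m (0 : C(Set.Icc (0 : ℝ) T, V)) = 0 := by
  have hm0 : 0 < m := by linarith
  simp [seminorm, hm0]

lemma seminorm_add_le (hm : 1 ≤ m) (f g : C(Set.Icc (0 : ℝ) T, V)) :
    seminorm α m (f + g) ≤ seminorm α m f + seminorm α m g := by
  have hm0 : 0 < m := by linarith
  rw [seminorm_eq hm, seminorm_eq hm, seminorm_eq hm]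
  refine le_trans ?_ (ENNReal.lintegral_Lp_add_le (measurable_quot f).aemeasurable
    (measurable_quot g).aemeasurable hm)
  refine ENNReal.rpow_le_rpow (lintegral_mono fun p => ?_) (by positivity)
  refine ENNReal.rpow_le_rpow ?_ hm0.le
  simp only [quot, Pi.add_apply, ContinuousMap.add_apply]
  rw [← ENNReal.add_div]
  gcongr
  rw [add_sub_add_comm]
  exact enorm_add_le _ _

lemma seminorm_smul [NormedSpace ℝ V] (hm : 1 ≤ m) (c : ℝ) (f : C(Set.Icc (0 : ℝ) T, V)) :
    seminorm α m (c • f) = ‖c‖ₑ * seminorm α m f := by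
  have hm0 : 0 < m := by linarith
  have key : ∀ p, quot α m (c • f) p ^ m = ‖c‖ₑ ^ m * quot α m f p ^ m := fun p => by
    rw [← ENNReal.mul_rpow_of_nonneg _ _ hm0.le]
    simp only [quot, ContinuousMap.smul_apply, ← smul_sub, enorm_smul, mul_div_assoc]
  rw [seminorm_eq hm, seminorm_eq hm]
  simp_rw [key]
  rw [lintegral_const_mul _ ((measurable_quot f).pow_const m),
    ENNReal.mul_rpow_of_nonneg _ _ (by positivity), ← ENNReal.rpow_mul, mul_one_div,
    div_self hm0.ne', ENNReal.rpow_one]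

lemma isOpenPosMeasure (hT : 0 < T) :
    (timeMeasure T).IsOpenPosMeasure := by
  refine ⟨fun U hU ⟨x, hx⟩ => ?_⟩
  obtain ⟨O, hO, rfl⟩ := isOpen_induced_iff.1 hU
  rw [timeMeasure, comap_subtype_coe_apply measurableSet_Icc, Subtype.image_preimage_coe]
  have hcl : (x : ℝ) ∈ closure (Set.Ioo (0 : ℝ) T) := by
    rw [closure_Ioo hT.ne]; exact x.2
  obtain ⟨y, hyO, hyI⟩ := mem_closure_iff.1 hcl O hO hx
  refine ne_of_gt (lt_of_lt_of_le ((hO.inter isOpen_Ioo).measure_pos volume ⟨y, hyO, hyI⟩)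
    (measure_mono ?_))
  exact fun z hz => ⟨Set.Ioo_subset_Icc_self hz.2, hz.1⟩

/-- A path with vanishing Besov seminorm is constant. -/
lemma eq_of_seminorm_eq_zero (hT : 0 < T) (hm : 1 ≤ m) (f : C(Set.Icc (0 : ℝ) T, V))
    (h : seminorm α m f = 0) (t : Set.Icc (0 : ℝ) T) : f t = f ⟨0, le_rfl, hT.le⟩ := by
  have hm0 : 0 < m := by linarith
  have := isOpenPosMeasure hT
  rw [seminorm_eq hm, ENNReal.rpow_eq_zero_iff_of_pos (by positivity),
    lintegral_eq_zero_iff ((measurable_quot f).pow_const m)] at h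
  have hopen : IsOpen {p : Set.Icc (0 : ℝ) T × Set.Icc (0 : ℝ) T | p.1 < p.2} :=
    isOpen_lt continuous_fst continuous_snd
  have h' := ae_restrict_of_ae_restrict_of_subset
    (s := {p : Set.Icc (0 : ℝ) T × Set.Icc (0 : ℝ) T | p.1 < p.2})
    (fun p (hp : p.1 < p.2) => hp.le) h
  have h2 : (fun p : Set.Icc (0 : ℝ) T × Set.Icc (0 : ℝ) T => ‖f p.2 - f p.1‖)
      =ᵐ[((timeMeasure T).prod (timeMeasure T)).restrict {p | p.1 < p.2}] fun _ => 0 := by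
    filter_upwards [h'] with p hp
    have hq : quot α m f p = 0 := by
      simpa [ENNReal.rpow_eq_zero_iff_of_pos hm0] using hp
    have h3 := (ENNReal.div_eq_zero_iff.1 hq).resolve_right
      (ENNReal.rpow_ne_top_of_nonneg (by positivity) ENNReal.ofReal_ne_top)
    simpa using h3
  have h4 := Measure.eqOn_open_of_ae_eq h2 hopen (Continuous.continuousOn (by fun_prop))
    continuousOn_const
  rcases t.2.1.eq_or_lt with h0 | h0
  · congr 1; exact Subtype.ext h0.symm
  · have h5 := h4 (x := (⟨0, le_rfl, hT.le⟩, t)) (by exact h0)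
    exact sub_eq_zero.1 (norm_eq_zero.1 h5)

end Lemmas

/-- The subspace of continuous paths with finite Besov seminorm. -/
def submodule (T α m : ℝ) [hm : Fact (1 ≤ m)] (V : Type*) [NormedAddCommGroup V]
    [NormedSpace ℝ V] : Submodule ℝ C(Set.Icc (0 : ℝ) T, V) where
  carrier := {f | seminorm α m f < ∞}
  add_mem' hf hg := (seminorm_add_le hm.out _ _).trans_lt (ENNReal.add_lt_top.2 ⟨hf, hg⟩)
  zero_mem' := by simp [seminorm_zero hm.out]
  smul_mem' c f hf := by
    simp only [Set.mem_ofPred_eq, seminorm_smul hm.out] at hf ⊢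
    exact ENNReal.mul_lt_top enorm_lt_top hf

end BesovPath

/-- The space `C^{B; α, m}([0, T], V)` of continuous paths with finite `(α, m)`-Besov norm
`‖f‖ = |f_0| + (∬_{0 ≤ s ≤ t ≤ T} |f_t - f_s|^m / |t - s|^(1 + α m) ds dt)^(1/m)`. -/
def BesovPath (T α m : ℝ) [Fact (1 ≤ m)] (V : Type*) [NormedAddCommGroup V]
    [NormedSpace ℝ V] : Type _ :=
  BesovPath.submodule T α m V

namespace BesovPath

variable {T α m : ℝ} [hm : Fact (1 ≤ m)] {V : Type*} [NormedAddCommGroup V] [NormedSpace ℝ V]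

instance : AddCommGroup (BesovPath T α m V) :=
  inferInstanceAs (AddCommGroup (BesovPath.submodule T α m V))

instance : Module ℝ (BesovPath T α m V) :=
  inferInstanceAs (Module ℝ (BesovPath.submodule T α m V))

/-- The underlying continuous path. -/
def toContinuousMap (f : BesovPath T α m V) : C(Set.Icc (0 : ℝ) T, V) := f.1

instance : CoeFun (BesovPath T α m V) fun _ => Set.Icc (0 : ℝ) T → V :=
  ⟨fun f => f.toContinuousMap⟩

variable [hT : Fact (0 < T)]

/-- The initial time `0`. -/
def start (T : ℝ) [hT : Fact (0 < T)] : Set.Icc (0 : ℝ) T := ⟨0, le_rfl, hT.out.le⟩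

instance : Norm (BesovPath T α m V) where
  norm f := ‖f (start T)‖ + (seminorm α m f.toContinuousMap).toReal

lemma norm_def (f : BesovPath T α m V) :
    ‖f‖ = ‖f (start T)‖ + (seminorm α m f.toContinuousMap).toReal := rfl

lemma core : NormedSpace.Core ℝ (BesovPath T α m V) where
  norm_nonneg f := by rw [norm_def]; positivity
  norm_smul c f := by
    rw [norm_def, norm_def]
    have h1 : (c • f).toContinuousMap = c • f.toContinuousMap := rfl
    rw [h1, seminorm_smul hm.out, ENNReal.toReal_mul, ContinuousMap.smul_apply, norm_smul]
    simp [mul_add]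
  norm_triangle f g := by
    rw [norm_def, norm_def, norm_def]
    have h1 : (f + g).toContinuousMap = f.toContinuousMap + g.toContinuousMap := rfl
    have h2 := ENNReal.toReal_mono (ENNReal.add_lt_top.2 ⟨f.2, g.2⟩).ne
      (seminorm_add_le (α := α) hm.out f.toContinuousMap g.toContinuousMap)
    rw [ENNReal.toReal_add (ne_of_lt f.2) (ne_of_lt g.2)] at h2
    have h3 := norm_add_le (f (start T)) (g (start T))
    rw [h1, ContinuousMap.add_apply]
    linarith!
  norm_eq_zero_iff f := by
    constructor
    · intro h
      rw [norm_def] at h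
      have h1 : ‖f (start T)‖ = 0 := le_antisymm
        (by linarith [ENNReal.toReal_nonneg (a := seminorm α m f.toContinuousMap)])
        (norm_nonneg _)
      have h2 : (seminorm α m f.toContinuousMap).toReal = 0 := by linarith
      have h3 := ((ENNReal.toReal_eq_zero_iff _).1 h2).resolve_right (ne_of_lt f.2)
      refine Subtype.ext (ContinuousMap.ext fun t => ?_)
      exact (eq_of_seminorm_eq_zero hT.out hm.out f.toContinuousMap h3 t).trans
        (norm_eq_zero.1 h1)
    · rintro rfl
      have h0 : (0 : BesovPath T α m V).toContinuousMap = 0 := rfl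
      rw [norm_def, h0, seminorm_zero hm.out]
      simp

instance : NormedAddCommGroup (BesovPath T α m V) := NormedAddCommGroup.ofCore core

instance : NormedSpace ℝ (BesovPath T α m V) := NormedSpace.ofCore core

instance : MeasurableSpace (BesovPath T α m V) := borel _

instance : BorelSpace (BesovPath T α m V) := ⟨rfl⟩

variable (T α m V) in
/-- The subspace `C_0^{B; α, m}([0, T], V)` of Besov paths that start at `0`, with the Besov
norm. -/
def startZero : Submodule ℝ (BesovPath T α m V) where
  carrier := {f | f (start T) = 0}
  add_mem' {f g} hf hg := by
    have h1 : (f + g).toContinuousMap = f.toContinuousMap + g.toContinuousMap := rfl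
    simp only [Set.mem_ofPred_eq] at hf hg ⊢
    rw [h1, ContinuousMap.add_apply, hf, hg, add_zero]
  zero_mem' := rfl
  smul_mem' c f hf := by
    have h1 : (c • f).toContinuousMap = c • f.toContinuousMap := rfl
    simp only [Set.mem_ofPred_eq] at hf ⊢
    rw [h1, ContinuousMap.smul_apply, hf, smul_zero]

end BesovPath

instance factZeroLtOne : Fact ((0 : ℝ) < 1) := ⟨one_pos⟩

/-- The space `C_0^{B; β, m}([0, T], C^{B; α, m}([0, 1], ℝ^d))` of sheets `(t, x) ↦ f(t, x)`,
a normed space with its Borel `σ`-algebra. -/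
abbrev SheetSpace (T α β m : ℝ) [Fact (0 < T)] [Fact (1 ≤ m)] (d : ℕ) : Type :=
  BesovPath.startZero T β m (BesovPath 1 α m (EuclideanSpace ℝ (Fin d)))

/-- The path `x ↦ f(t, x)`. -/
def SheetSpace.slice {T α β m : ℝ} [Fact (0 < T)] [Fact (1 ≤ m)] {d : ℕ}
    (f : SheetSpace T α β m d) (t : Set.Icc (0 : ℝ) T) :
    Set.Icc (0 : ℝ) 1 → EuclideanSpace ℝ (Fin d) :=
  (f : BesovPath T β m (BesovPath 1 α m (EuclideanSpace ℝ (Fin d)))) t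

/-! ### The stochastic heat equation on the circle -/

/-- The heat kernel `p_t(x)` of `∂_t - ∂_x²` on `ℝ`. -/
def heatKernel (t x : ℝ) : ℝ := 1 / √(4 * Real.pi * t) * Real.exp (-(x ^ 2) / (4 * t))

/-- The heat kernel of the circle `ℝ/ℤ`, as a `1`-periodic function. -/
def periodicHeatKernel (t x : ℝ) : ℝ := ∑' n : ℤ, heatKernel t (x + n)

/-- Lebesgue measure on `[0, T] × S¹`, the circle being identified with `[0, 1]`. -/
def spaceTimeMeasure (T : ℝ) : Measure (ℝ × ℝ) :=
  (volume.restrict (Set.Icc 0 T)).prod (volume.restrict (Set.Icc 0 1))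

/-- The integrand `(s, y) ↦ 1_{s < t} p̃_{t-s}(x - y)` of the stochastic convolution. -/
def duhamelKernel (t x : ℝ) (p : ℝ × ℝ) : ℝ :=
  if p.1 < t then periodicHeatKernel (t - p.1) (x - p.2) else 0

/-- A space-time white noise on `[0, T] × S¹` over `(Ω, P)`: a linear map `f ↦ ξ(f)` from
`L²([0, T] × S¹)` to `L²(P)` such that `ξ(f)` is centred Gaussian with variance `‖f‖²`. -/
def IsWhiteNoise {Ω : Type*} [MeasurableSpace Ω] (T : ℝ) (P : Measure Ω)
    (ξ : Lp ℝ 2 (spaceTimeMeasure T) →ₗ[ℝ] Lp ℝ 2 P) : Prop :=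
  ∀ f : Lp ℝ 2 (spaceTimeMeasure T), HasLaw (ξ f) (gaussianReal 0 (‖f‖₊ ^ 2)) P

/-- `ψ` is (a version with values in the sheet space of) the mild solution
`ψ^i(t, x) = ∫_0^t ∫_{S¹} p̃_{t-s}(x - y) ξ^i(ds, dy)` of the `ℝ^d`-valued stochastic heat equation
`∂_t ψ = Δ ψ + ξ`, `ψ(0, ·) = 0`, driven by independent white noises `ξ^1, …, ξ^d`. -/
structure IsStochasticHeatSheet {Ω : Type*} [MeasurableSpace Ω] {T α β m : ℝ} [Fact (0 < T)]
    [Fact (1 ≤ m)] {d : ℕ} (P : Measure Ω)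
    (ξ : Fin d → Lp ℝ 2 (spaceTimeMeasure T) →ₗ[ℝ] Lp ℝ 2 P)
    (ψ : Ω → SheetSpace T α β m d) : Prop where
  isWhiteNoise : ∀ i, IsWhiteNoise T P (ξ i)
  indep : iIndepFun (fun i ω (f : Lp ℝ 2 (spaceTimeMeasure T)) => ξ i f ω) P
  aemeasurable : AEMeasurable ψ P
  mild : ∀ (t : Set.Icc (0 : ℝ) T) (x : Set.Icc (0 : ℝ) 1) (i : Fin d),
    ∃ hK : MemLp (duhamelKernel t x) 2 (spaceTimeMeasure T),
      (fun ω => (ψ ω).slice t x i) =ᵐ[P] ξ i (hK.toLp _)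

/-! ### Cameron–Martin space, Hölder norm and variation norm -/

/-- The Cameron–Martin norm `sup {ℓ(h) | ℓ ∈ E', Var_μ(ℓ) ≤ 1}` of `h ∈ E` for a Gaussian
measure `μ` on a normed space `E`. -/
def cameronMartinNorm {E : Type*} [NormedAddCommGroup E] [NormedSpace ℝ E] [MeasurableSpace E]
    (μ : Measure E) (h : E) : ℝ≥0∞ :=
  ⨆ (ℓ : StrongDual ℝ E) (_ : evariance ℓ μ ≤ 1), ENNReal.ofReal (ℓ h)

/-- The Cameron–Martin space of a Gaussian measure: the vectors of finite Cameron–Martin norm. -/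
def cameronMartinSpace {E : Type*} [NormedAddCommGroup E] [NormedSpace ℝ E] [MeasurableSpace E]
    (μ : Measure E) : Set E :=
  {h | cameronMartinNorm μ h < ∞}

/-- The `α`-Hölder norm `|f(0)| + sup_{x < y} |f(y) - f(x)| / |y - x|^α` of a path on `[0, 1]`. -/
def holderNorm {V : Type*} [NormedAddCommGroup V] (α : ℝ) (f : Set.Icc (0 : ℝ) 1 → V) : ℝ≥0∞ :=
  ‖f 0‖ₑ + ⨆ (x : Set.Icc (0 : ℝ) 1) (y : Set.Icc (0 : ℝ) 1) (_ : x < y),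
    ‖f y - f x‖ₑ / ENNReal.ofReal (|(y : ℝ) - (x : ℝ)| ^ α)

/-- The `q`-variation norm `(sup ∑ |f(x_{i+1}) - f(x_i)|^q)^(1/q)` of a path on `[0, 1]`, the
supremum being over all finite increasing sequences of points of `[0, 1]`. -/
def variationNorm {V : Type*} [NormedAddCommGroup V] (q : ℝ) (f : Set.Icc (0 : ℝ) 1 → V) :
    ℝ≥0∞ :=
  (⨆ p : ℕ × {u : ℕ → Set.Icc (0 : ℝ) 1 // Monotone u},
    ∑ i ∈ Finset.range p.1, ‖f (p.2.1 (i + 1)) - f (p.2.1 i)‖ₑ ^ q) ^ (1 / q)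

end

/-! The Cameron–Martin norm is a supremum over functionals, so every continuous `ℓ` gives `ℓ(h) ≤
Var(ℓ)^(1/2) ‖h‖`, and it suffices to choose `ℓ` well. With `w_j = h(t, u_{j+1}) - h(t, u_j)`, take
`ℓ(f) = Σ_j ⟨w_j/|w_j|, f(t, u_{j+1}) - f(t, u_j)⟩`; then `ℓ(h) = Σ_j |w_j|`.

The variance is explicit. By the white noise isometry and Parseval on the circle, testing one
component of `ψ(t, ·)` against a finite signed measure `a` has variance `Σ_n (∫_0^t e^{-8π²n²(t-s)}
ds) |â(n)|²`, where for `n ≠ 0` the time integral is at most `1/(8π²n²)`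
(`lintegral_enorm_sq_duhamelCombination`, `evariance_combination`). For increments, `a` is minus the
derivative of a step function `g`, so `â(0) = 0` and `|â(n)|² = 4π²n²|ĝ(n)|²`. Summed over the
components, the variance is at most `½‖g‖² ≤ ½(u_N - u_0)`, because `|g| ≤ 1`.

This bounds `Σ_j |w_j|` (`sum_enorm_slice_sub_le`). A single interval gives the Hölder estimate. All
partitions together bound the total variation, which dominates the `q`-variation for `q ≥ 1`. The
value at `0` is treated with one point mass, whose zero mode contributes `t ≤ T` to the variance.

That `ℓ` is continuous on the sheet space requires point evaluations to be continuous in the Besov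
norm; this is the embedding `exists_enorm_sub_le`. -/

noncomputable section

namespace BesovPath

/-! ### Besov paths: oscillation bounded by the seminorm. -/

section Embedding

variable {T : ℝ} {β m : ℝ} {V : Type*} [NormedAddCommGroup V]

/-- The seminorm only sees the triangle `r ≤ s`; folding the square `I × I` along the diagonal costs
the factor `2`. On the triangle the denominator of the seminorm is at most `L^(1 + β m)`. -/
lemma lintegral_enorm_sub_rpow_le (hm : 1 ≤ m) (hβ : 0 ≤ β) (f : C(Set.Icc (0 : ℝ) T, V))
    {I : Set (Set.Icc (0 : ℝ) T)} (hI : MeasurableSet I) {L : ℝ}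
    (hL : ∀ r ∈ I, ∀ s ∈ I, |(s : ℝ) - r| ≤ L) :
    ∫⁻ p in I ×ˢ I, ‖f p.2 - f p.1‖ₑ ^ m ∂((timeMeasure T).prod (timeMeasure T)) ≤
      2 * (ENNReal.ofReal (L ^ (1 + β * m)) * seminorm β m f ^ m) := by
  have hm0 : 0 < m := by linarith
  set ν := (timeMeasure T).prod (timeMeasure T)
  set D : Set (Set.Icc (0 : ℝ) T × Set.Icc (0 : ℝ) T) := {p | p.1 ≤ p.2}
  have hD : MeasurableSet D := (isClosed_le continuous_fst continuous_snd).measurableSet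
  have hII : MeasurableSet (I ×ˢ I) := hI.prod hI
  set F : Set.Icc (0 : ℝ) T × Set.Icc (0 : ℝ) T → ℝ≥0∞ := fun p => ‖f p.2 - f p.1‖ₑ ^ m
  have hsplit : I ×ˢ I ⊆ (I ×ˢ I ∩ D) ∪ Prod.swap ⁻¹' (I ×ˢ I ∩ D) := by
    rintro ⟨r, s⟩ ⟨hr, hs⟩
    rcases le_total r s with h | h
    · exact Or.inl ⟨⟨hr, hs⟩, h⟩
    · exact Or.inr ⟨⟨hs, hr⟩, h⟩
  have hswap : ∫⁻ p in Prod.swap ⁻¹' (I ×ˢ I ∩ D), F p ∂ν = ∫⁻ p in I ×ˢ I ∩ D, F p ∂ν := by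
    have hmp : MeasurePreserving Prod.swap ν ν := Measure.measurePreserving_swap
    rw [← hmp.setLIntegral_comp_preimage_emb MeasurableEquiv.prodComm.measurableEmbedding]
    refine lintegral_congr fun p => ?_
    simp only [F, Prod.fst_swap, Prod.snd_swap, ← edist_eq_enorm_sub, edist_comm]
  have hbound : ∫⁻ p in I ×ˢ I ∩ D, F p ∂ν ≤
      ENNReal.ofReal (L ^ (1 + β * m)) * seminorm β m f ^ m := by
    rw [seminorm, ← ENNReal.rpow_mul, one_div, inv_mul_cancel₀ hm0.ne', ENNReal.rpow_one,
      ← lintegral_const_mul' _ _ ENNReal.ofReal_ne_top]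
    refine (setLIntegral_mono' (hII.inter hD) fun p hp => ?_).trans
      (lintegral_mono_set Set.inter_subset_right)
    by_cases hpp : p.1 = p.2
    · simp [F, hpp, hm0]
    have hpos : 0 < |(p.2 : ℝ) - p.1| :=
      abs_pos.2 (sub_ne_zero.2 fun h => hpp (Subtype.ext h.symm))
    have hle := hL _ hp.1.1 _ hp.1.2
    rw [← mul_div_assoc, ENNReal.le_div_iff_mul_le
      (Or.inl (ENNReal.ofReal_pos.2 (by positivity)).ne') (Or.inl ENNReal.ofReal_ne_top), mul_comm]
    gcongr
  calc ∫⁻ p in I ×ˢ I, F p ∂ν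
      ≤ ∫⁻ p in (I ×ˢ I ∩ D) ∪ Prod.swap ⁻¹' (I ×ˢ I ∩ D), F p ∂ν := lintegral_mono_set hsplit
    _ ≤ _ := lintegral_union_le _ _ _
    _ ≤ _ := by rw [hswap, two_mul]; gcongr

/-- Hölder's inequality on a square of measure `L²`; the exponents add up as `(1 + β m)/m + 2(1 -
1/m) = 2 + β - 1/m`. -/
lemma lintegral_enorm_sub_le (hm : 1 ≤ m) (hβ : 0 ≤ β) (f : C(Set.Icc (0 : ℝ) T, V))
    {I : Set (Set.Icc (0 : ℝ) T)} (hI : MeasurableSet I) {L : ℝ} (hL0 : 0 < L)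
    (hL : ∀ r ∈ I, ∀ s ∈ I, |(s : ℝ) - r| ≤ L) (hν : timeMeasure T I = ENNReal.ofReal L) :
    ∫⁻ p in I ×ˢ I, ‖f p.2 - f p.1‖ₑ ∂((timeMeasure T).prod (timeMeasure T)) ≤
      2 * ENNReal.ofReal (L ^ 2 * L ^ (β - 1 / m)) * seminorm β m f := by
  have hm0 : 0 < m := by linarith
  set ν := ((timeMeasure T).prod (timeMeasure T)).restrict (I ×ˢ I)
  have h1 := eLpNorm_le_eLpNorm_mul_rpow_measure_univ (μ := ν)
    (f := fun p => ‖f p.2 - f p.1‖) (p := 1) (q := ENNReal.ofReal m) (by simpa using hm)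
    (Continuous.measurable (by fun_prop)).stronglyMeasurable.aestronglyMeasurable
  rw [eLpNorm_one_eq_lintegral_enorm, eLpNorm_eq_lintegral_rpow_enorm_toReal
    (by simpa using hm0) ENNReal.ofReal_ne_top] at h1
  simp only [enorm_norm, ENNReal.toReal_one, ENNReal.toReal_ofReal hm0.le, div_one] at h1
  refine h1.trans ?_
  have hone : 1 - 1 / m ≥ 0 := by rw [ge_iff_le, sub_nonneg, div_le_one hm0]; exact hm
  have huniv : ν Set.univ = ENNReal.ofReal (L ^ 2) := by
    rw [Measure.restrict_apply_univ, Measure.prod_prod, hν, ← ENNReal.ofReal_mul hL0.le, sq]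
  rw [huniv]
  have h2 : (2 : ℝ≥0∞) ^ (1 / m) ≤ 2 := by
    conv_rhs => rw [← ENNReal.rpow_one 2]
    exact ENNReal.rpow_le_rpow_of_exponent_le (by norm_num) (by rw [div_le_one hm0]; exact hm)
  calc (∫⁻ p, ‖f p.2 - f p.1‖ₑ ^ m ∂ν) ^ (1 / m) * ENNReal.ofReal (L ^ 2) ^ (1 - 1 / m)
      ≤ (2 * (ENNReal.ofReal (L ^ (1 + β * m)) * seminorm β m f ^ m)) ^ (1 / m) *
          ENNReal.ofReal (L ^ 2) ^ (1 - 1 / m) := by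
        gcongr
        exact lintegral_enorm_sub_rpow_le hm hβ f hI hL
    _ = 2 ^ (1 / m) * (ENNReal.ofReal (L ^ (1 + β * m)) ^ (1 / m) *
          ENNReal.ofReal (L ^ 2) ^ (1 - 1 / m)) * seminorm β m f := by
        rw [ENNReal.mul_rpow_of_nonneg _ _ (by positivity),
          ENNReal.mul_rpow_of_nonneg _ _ (by positivity), ← ENNReal.rpow_mul, mul_one_div,
          div_self hm0.ne', ENNReal.rpow_one]
        ring
    _ ≤ 2 * (ENNReal.ofReal (L ^ (1 + β * m)) ^ (1 / m) *
          ENNReal.ofReal (L ^ 2) ^ (1 - 1 / m)) * seminorm β m f := by gcongr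
    _ = _ := by
        rw [ENNReal.ofReal_rpow_of_pos (by positivity), ENNReal.ofReal_rpow_of_pos (by positivity),
          ← ENNReal.ofReal_mul (by positivity), ← Real.rpow_natCast, ← Real.rpow_mul hL0.le,
          ← Real.rpow_mul hL0.le, ← Real.rpow_add hL0, ← Real.rpow_add hL0]
        congr 4
        push_cast
        field_simp
        ring

/-- One step of a telescoping argument: the mean distance to `f t` changes little when the interval
is halved. Insert `f r` with `r ∈ J`, integrate over `J × I`, and enlarge to `I × I`. The constant
`4` is the `2` of the preceding bound times `L² / (L · L/2)`. -/
lemma lintegral_enorm_sub_div_le (hm : 1 ≤ m) (hβ : 0 ≤ β) (f : C(Set.Icc (0 : ℝ) T, V))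
    (t : Set.Icc (0 : ℝ) T) {I J : Set (Set.Icc (0 : ℝ) T)} (hI : MeasurableSet I)
    (hJI : J ⊆ I) {L : ℝ} (hL0 : 0 < L)
    (hL : ∀ r ∈ I, ∀ s ∈ I, |(s : ℝ) - r| ≤ L) (hν : timeMeasure T I = ENNReal.ofReal L)
    (hνJ : timeMeasure T J = ENNReal.ofReal (L / 2)) :
    (∫⁻ s in I, ‖f t - f s‖ₑ ∂timeMeasure T) / ENNReal.ofReal L ≤
      (∫⁻ s in J, ‖f t - f s‖ₑ ∂timeMeasure T) / ENNReal.ofReal (L / 2) +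
        4 * (ENNReal.ofReal (L ^ (β - 1 / m)) * seminorm β m f) := by
  set ν := timeMeasure T
  have hmeas : ∀ x, Measurable fun s => ‖f x - f s‖ₑ := fun x =>
    Continuous.measurable (by fun_prop)
  have hmeas' : ∀ x, Measurable fun s => ‖f s - f x‖ₑ := fun x =>
    Continuous.measurable (by fun_prop)
  have key : ν J * ∫⁻ s in I, ‖f t - f s‖ₑ ∂ν ≤ ν I * ∫⁻ s in J, ‖f t - f s‖ₑ ∂ν +
      2 * ENNReal.ofReal (L ^ 2 * L ^ (β - 1 / m)) * seminorm β m f := by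
    calc ν J * ∫⁻ s in I, ‖f t - f s‖ₑ ∂ν
        = ∫⁻ r in J, ∫⁻ s in I, ‖f t - f s‖ₑ ∂ν ∂ν := by simp [mul_comm]
      _ ≤ ∫⁻ r in J, ∫⁻ s in I, (‖f t - f r‖ₑ + ‖f s - f r‖ₑ) ∂ν ∂ν := by
          refine lintegral_mono fun r => lintegral_mono fun s => ?_
          simp only [← edist_eq_enorm_sub]
          rw [edist_comm (f s)]
          exact edist_triangle _ _ _
      _ = ∫⁻ r in J, (ν I * ‖f t - f r‖ₑ + ∫⁻ s in I, ‖f s - f r‖ₑ ∂ν) ∂ν := by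
          refine lintegral_congr fun r => ?_
          rw [lintegral_add_left measurable_const]
          simp [mul_comm]
      _ = ν I * ∫⁻ s in J, ‖f t - f s‖ₑ ∂ν + ∫⁻ r in J, ∫⁻ s in I, ‖f s - f r‖ₑ ∂ν ∂ν := by
          rw [lintegral_add_left ((hmeas t).const_mul _), lintegral_const_mul _ (hmeas t)]
      _ ≤ ν I * ∫⁻ s in J, ‖f t - f s‖ₑ ∂ν + ∫⁻ r in I, ∫⁻ s in I, ‖f s - f r‖ₑ ∂ν ∂ν := by
          gcongr
      _ ≤ _ := by
          gcongr
          refine le_trans (le_of_eq ?_) (lintegral_enorm_sub_le hm hβ f hI hL0 hL hν)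
          rw [← Measure.prod_restrict, lintegral_prod]
          exact (Continuous.measurable (by fun_prop)).aemeasurable
  rw [hν, hνJ] at key
  have e1 : ENNReal.ofReal L ≠ 0 := by simpa using hL0
  have e2 : ENNReal.ofReal (L / 2) ≠ 0 := by simpa using hL0
  have e3 : ENNReal.ofReal L ≠ ∞ := ENNReal.ofReal_ne_top
  have e4 : ENNReal.ofReal (L / 2) ≠ ∞ := ENNReal.ofReal_ne_top
  have e5 : ENNReal.ofReal (L ^ 2 * L ^ (β - 1 / m)) = 2 * (ENNReal.ofReal L *
      ENNReal.ofReal (L / 2) * ENNReal.ofReal (L ^ (β - 1 / m))) := by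
    rw [← ENNReal.ofReal_mul (by positivity), ← ENNReal.ofReal_mul (by positivity),
      show (2 : ℝ≥0∞) = ENNReal.ofReal 2 by simp, ← ENNReal.ofReal_mul (by positivity)]
    congr 1; ring
  rw [ENNReal.div_le_iff e1 e3]
  refine (ENNReal.mul_le_mul_iff_right e2 e4).1 (key.trans (le_of_eq ?_))
  rw [e5, ENNReal.div_eq_inv_mul]
  set a := ENNReal.ofReal L
  set b := ENNReal.ofReal (L / 2)
  set A := ∫⁻ s in J, ‖f t - f s‖ₑ ∂ν
  calc a * A + 2 * (2 * (a * b * ENNReal.ofReal (L ^ (β - 1 / m)))) * seminorm β m f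
      = (b * b⁻¹) * (a * A) +
          2 * (2 * (a * b * ENNReal.ofReal (L ^ (β - 1 / m)))) * seminorm β m f := by
        rw [ENNReal.mul_inv_cancel e2 e4, one_mul]
    _ = _ := by ring

/-- The points `s` of `[0, T]` with `s = t + λ (u - t)` for some `u ∈ [0, T]`. -/
def shrink (t : Set.Icc (0 : ℝ) T) (l : ℝ) : Set (Set.Icc (0 : ℝ) T) :=
  {s | (t : ℝ) - l * t ≤ s ∧ (s : ℝ) ≤ t + l * (T - t)}

lemma measurableSet_shrink (t : Set.Icc (0 : ℝ) T) (l : ℝ) : MeasurableSet (shrink t l) :=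
  ((isClosed_le continuous_const continuous_subtype_val).inter
    (isClosed_le continuous_subtype_val continuous_const)).measurableSet

/-- Contracting `[0, T]` towards `t`, instead of centring an interval at `t`, gives length exactly
`T l` even near the endpoints. -/
lemma timeMeasure_shrink (t : Set.Icc (0 : ℝ) T) {l : ℝ} (hl : l ≤ 1) :
    timeMeasure T (shrink t l) = ENNReal.ofReal (T * l) := by
  rw [timeMeasure, comap_subtype_coe_apply measurableSet_Icc]
  have : Subtype.val '' shrink t l = Set.Icc ((t : ℝ) - l * t) (t + l * (T - t)) := by
    ext x
    constructor
    · rintro ⟨s, hs, rfl⟩; exact hs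
    · rintro ⟨h1, h2⟩
      have := t.2.1
      have := t.2.2
      exact ⟨⟨x, by nlinarith, by nlinarith⟩, ⟨h1, h2⟩, rfl⟩
  rw [this, Real.volume_Icc]
  congr 1; ring

lemma shrink_subset (t : Set.Icc (0 : ℝ) T) {l l' : ℝ} (hl : l ≤ l') :
    shrink t l ⊆ shrink t l' := fun s hs => by
  have := t.2.1
  have := t.2.2
  exact ⟨by nlinarith [hs.1], by nlinarith [hs.2]⟩

lemma abs_sub_le_of_mem_shrink {t : Set.Icc (0 : ℝ) T} {l : ℝ} {r s : Set.Icc (0 : ℝ) T}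
    (hr : r ∈ shrink t l) (hs : s ∈ shrink t l) : |(s : ℝ) - r| ≤ T * l := by
  rw [abs_le]
  exact ⟨by linarith [hr.2, hs.1], by linarith [hr.1, hs.2]⟩

lemma mem_shrink (t : Set.Icc (0 : ℝ) T) {l : ℝ} (hl : 0 ≤ l) : t ∈ shrink t l := by
  have := t.2.1
  have := t.2.2
  exact ⟨by nlinarith, by nlinarith⟩

lemma tendsto_average_shrink (hT : 0 < T) (f : C(Set.Icc (0 : ℝ) T, V)) (t : Set.Icc (0 : ℝ) T) :
    Filter.Tendsto (fun n : ℕ => (∫⁻ s in shrink t ((1 / 2) ^ n), ‖f t - f s‖ₑ ∂timeMeasure T) /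
      ENNReal.ofReal (T * (1 / 2) ^ n)) Filter.atTop (nhds 0) := by
  rw [ENNReal.tendsto_nhds_zero]
  intro ε hε
  have hc : ContinuousAt (fun s => ‖f t - f s‖ₑ) t := Continuous.continuousAt (by fun_prop)
  have h0 : ∀ᶠ s in nhds t, ‖f t - f s‖ₑ ≤ ε := by
    have := hc.eventually_lt (continuousAt_const (y := ε)) (by simpa using hε)
    exact this.mono fun s hs => hs.le
  obtain ⟨δ, hδ, hball⟩ := Metric.eventually_nhds_iff.1 h0
  have hlim : Filter.Tendsto (fun n : ℕ => T * (1 / 2 : ℝ) ^ n) Filter.atTop (nhds 0) := by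
    simpa using (tendsto_pow_atTop_nhds_zero_of_lt_one (r := (1 / 2 : ℝ)) (by norm_num)
      (by norm_num)).const_mul T
  filter_upwards [hlim.eventually_lt_const hδ] with n hn
  have hp : 0 < T * (1 / 2 : ℝ) ^ n := by positivity
  rw [ENNReal.div_le_iff (by simpa using hp) ENNReal.ofReal_ne_top]
  calc ∫⁻ s in shrink t ((1 / 2) ^ n), ‖f t - f s‖ₑ ∂timeMeasure T
      ≤ ∫⁻ s in shrink t ((1 / 2) ^ n), ε ∂timeMeasure T := by
        refine setLIntegral_mono' (measurableSet_shrink _ _) fun s hs => hball ?_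
        exact (abs_sub_le_of_mem_shrink (mem_shrink t (by positivity)) hs).trans_lt hn
    _ = _ := by
        rw [setLIntegral_const, timeMeasure_shrink _ (pow_le_one₀ (by norm_num) (by norm_num))]

/-- Telescoping over dyadic contractions towards `t`; the means over the small intervals tend to `0`
by continuity. The series takes values in `ℝ≥0∞`, so its convergence matters only later. -/
lemma average_enorm_sub_le (hT : 0 < T) (hm : 1 ≤ m) (hβ : 0 ≤ β) (f : C(Set.Icc (0 : ℝ) T, V))
    (t : Set.Icc (0 : ℝ) T) :
    (∫⁻ s, ‖f t - f s‖ₑ ∂timeMeasure T) / ENNReal.ofReal T ≤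
      (∑' n : ℕ, 4 * ENNReal.ofReal ((T * (1 / 2) ^ n) ^ (β - 1 / m))) * seminorm β m f := by
  set a : ℕ → ℝ≥0∞ := fun n => (∫⁻ s in shrink t ((1 / 2) ^ n), ‖f t - f s‖ₑ ∂timeMeasure T) /
      ENNReal.ofReal (T * (1 / 2) ^ n)
  set b : ℕ → ℝ≥0∞ := fun n => 4 * ENNReal.ofReal ((T * (1 / 2) ^ n) ^ (β - 1 / m))
  have hstep : ∀ n, a n ≤ a (n + 1) + b n * seminorm β m f := fun n => by
    have hpow : (1 / 2 : ℝ) ^ (n + 1) ≤ (1 / 2) ^ n :=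
      pow_le_pow_of_le_one (by norm_num) (by norm_num) n.le_succ
    have hle : (1 / 2 : ℝ) ^ n ≤ 1 := pow_le_one₀ (by norm_num) (by norm_num)
    have hhalf : T * (1 / 2 : ℝ) ^ (n + 1) = T * (1 / 2) ^ n / 2 := by ring
    have := lintegral_enorm_sub_div_le hm hβ f t (measurableSet_shrink t ((1 / 2) ^ n))
      (shrink_subset t hpow) (L := T * (1 / 2) ^ n) (by positivity)
      (fun r hr s hs => abs_sub_le_of_mem_shrink hr hs) (timeMeasure_shrink t hle)
      (by rw [timeMeasure_shrink t (hpow.trans hle), hhalf])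
    simpa only [a, b, hhalf, mul_assoc] using this
  have hsum : ∀ n, a 0 ≤ a n + (∑ k ∈ Finset.range n, b k) * seminorm β m f := fun n => by
    induction n with
    | zero => simp
    | succ n ih =>
      refine ih.trans ?_
      rw [Finset.sum_range_succ, add_mul, add_comm (_ * _), ← add_assoc]
      gcongr
      exact hstep n
  have h0 : a 0 = (∫⁻ s, ‖f t - f s‖ₑ ∂timeMeasure T) / ENNReal.ofReal T := by
    have : shrink t 1 = Set.univ := by
      refine Set.eq_univ_of_forall fun s => ⟨?_, ?_⟩
      · simpa using s.2.1
      · simpa using s.2.2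
    simp only [a, pow_zero, mul_one, this, Measure.restrict_univ]
  rw [← h0]
  refine ge_of_tendsto (x := Filter.atTop) ((zero_add (_ * _ : ℝ≥0∞)) ▸
    (tendsto_average_shrink hT f t).add_const _) (Filter.Eventually.of_forall fun n => ?_)
  refine (hsum n).trans ?_
  gcongr
  exact ENNReal.sum_le_tsum _

/-- The Besov seminorm controls the oscillation if `β > 1 / m`. -/
lemma exists_enorm_sub_le (hT : 0 < T) (hm : 1 ≤ m) (hβ : 1 / m < β) :
    ∃ C : ℝ≥0∞, C ≠ ∞ ∧ ∀ (f : C(Set.Icc (0 : ℝ) T, V)) (s t : Set.Icc (0 : ℝ) T),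
      ‖f t - f s‖ₑ ≤ C * seminorm β m f := by
  have hβ0 : 0 ≤ β := le_trans (by positivity) hβ.le
  have hγ : 0 < β - 1 / m := sub_pos.2 hβ
  set K := ∑' n : ℕ, 4 * ENNReal.ofReal ((T * (1 / 2) ^ n) ^ (β - 1 / m))
  have hK : K ≠ ∞ := by
    have hr : ∀ n : ℕ, (T * (1 / 2 : ℝ) ^ n) ^ (β - 1 / m) =
        T ^ (β - 1 / m) * ((1 / 2 : ℝ) ^ (β - 1 / m)) ^ n := fun n => by
      rw [Real.mul_rpow hT.le (by positivity), ← Real.rpow_natCast, ← Real.rpow_natCast,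
        ← Real.rpow_mul (by norm_num), ← Real.rpow_mul (by norm_num), mul_comm (n : ℝ)]
    have hsummable : Summable fun n : ℕ => (T * (1 / 2 : ℝ) ^ n) ^ (β - 1 / m) := by
      simp_rw [hr]
      exact (summable_geometric_of_lt_one (by positivity)
        (Real.rpow_lt_one (by norm_num) (by norm_num) hγ)).mul_left _
    rw [show K = 4 * ∑' n : ℕ, ENNReal.ofReal ((T * (1 / 2) ^ n) ^ (β - 1 / m)) from
      ENNReal.tsum_mul_left]
    exact ENNReal.mul_ne_top (by simp) hsummable.tsum_ofReal_ne_top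
  -- Both `f t` and `f s` are compared with the values of `f` averaged over all of `[0, T]`, hence
  -- twice `K`; `β > 1 / m` makes the series geometric with ratio below `1`.
  refine ⟨2 * K, ENNReal.mul_ne_top (by simp) hK, fun f s t => ?_⟩
  have huniv : timeMeasure T Set.univ = ENNReal.ofReal T := by
    rw [timeMeasure, comap_subtype_coe_apply measurableSet_Icc, Set.image_univ, Subtype.range_coe,
      Real.volume_Icc, sub_zero]
  have hT' : ENNReal.ofReal T ≠ 0 := by simpa using hT
  calc ‖f t - f s‖ₑ = (∫⁻ _, ‖f t - f s‖ₑ ∂timeMeasure T) / ENNReal.ofReal T := by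
        rw [lintegral_const, huniv, ENNReal.mul_div_cancel_right hT' ENNReal.ofReal_ne_top]
    _ ≤ (∫⁻ r, (‖f t - f r‖ₑ + ‖f s - f r‖ₑ) ∂timeMeasure T) / ENNReal.ofReal T := by
        gcongr with r
        simp only [← edist_eq_enorm_sub]
        rw [edist_comm (f s)]
        exact edist_triangle _ _ _
    _ = (∫⁻ r, ‖f t - f r‖ₑ ∂timeMeasure T) / ENNReal.ofReal T +
          (∫⁻ r, ‖f s - f r‖ₑ ∂timeMeasure T) / ENNReal.ofReal T := by
        rw [lintegral_add_left (Continuous.measurable (by fun_prop)), ENNReal.add_div]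
    _ ≤ K * seminorm β m f + K * seminorm β m f :=
        add_le_add (average_enorm_sub_le hT hm hβ0 f t) (average_enorm_sub_le hT hm hβ0 f s)
    _ = _ := by ring

end Embedding

/-! ### Continuity of point evaluations. -/

section Evaluation

variable {T β m : ℝ} [hm : Fact (1 ≤ m)] [hT : Fact (0 < T)]
  {V : Type*} [NormedAddCommGroup V] [NormedSpace ℝ V]

/-- Evaluation at a point, as a linear map. -/
def evalₗ (β m : ℝ) [Fact (1 ≤ m)] (V : Type*) [NormedAddCommGroup V] [NormedSpace ℝ V]
    (t : Set.Icc (0 : ℝ) T) : BesovPath T β m V →ₗ[ℝ] V where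
  toFun f := f t
  map_add' _ _ := rfl
  map_smul' _ _ := rfl

lemma continuous_evalₗ (hβ : 1 / m < β) (t : Set.Icc (0 : ℝ) T) :
    Continuous (evalₗ β m V t) := by
  obtain ⟨C, hC, h⟩ := exists_enorm_sub_le (V := V) hT.out hm.out hβ
  refine AddMonoidHomClass.continuous_of_bound (evalₗ β m V t) (1 + C.toReal) fun f => ?_
  have h1 := h f.toContinuousMap (start T) t
  have hfin : seminorm β m f.toContinuousMap ≠ ∞ := ne_of_lt f.2
  have h2 := ENNReal.toReal_mono (ENNReal.mul_ne_top hC hfin) h1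
  rw [toReal_enorm, ENNReal.toReal_mul] at h2
  have h3 : ‖f t‖ ≤ ‖f (start T)‖ + ‖f t - f (start T)‖ := norm_le_norm_add_norm_sub' _ _
  rw [norm_def]
  change ‖f t‖ ≤ _
  have h4 := norm_nonneg (f (start T))
  have h5 : 0 ≤ (seminorm β m f.toContinuousMap).toReal := ENNReal.toReal_nonneg
  have h6 : 0 ≤ C.toReal := ENNReal.toReal_nonneg
  nlinarith

end Evaluation

end BesovPath

/-! ### Fourier series of the heat kernel and the exact variance. -/

section HeatFourier

/-- The `n`-th Fourier multiplier of the heat semigroup of the circle. -/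
def heatMultiplier (τ : ℝ) (n : ℤ) : ℝ := Real.exp (-(4 * Real.pi ^ 2 * n ^ 2) * τ)

lemma heatMultiplier_pos (τ : ℝ) (n : ℤ) : 0 < heatMultiplier τ n := Real.exp_pos _

lemma summable_heatMultiplier {τ : ℝ} (hτ : 0 < τ) : Summable (heatMultiplier τ) := by
  have := summable_pow_mul_jacobiTheta₂_term_bound 0 (T := 4 * Real.pi * τ) (by positivity) 0
  refine this.congr fun n => ?_
  rw [pow_zero, one_mul, heatMultiplier]
  congr 1; ring

lemma norm_fourier_apply (n : ℤ) (z : UnitAddCircle) : ‖fourier n z‖ = 1 := Circle.norm_coe _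

/-- The Fourier series of the heat kernel of the circle. -/
lemma hasSum_periodicHeatKernel {τ : ℝ} (hτ : 0 < τ) (x z : ℝ) :
    HasSum (fun n : ℤ => (heatMultiplier τ n * fourier (-n) (x : UnitAddCircle)) *
      fourier n (z : UnitAddCircle)) (periodicHeatKernel τ (x - z) : ℂ) := by
  have hs : Summable fun n : ℤ => (heatMultiplier τ n * fourier (-n) (x : UnitAddCircle)) *
      fourier n (z : UnitAddCircle) := by
    refine Summable.of_norm_bounded (summable_heatMultiplier hτ) fun n => ?_
    rw [norm_mul, norm_mul, norm_fourier_apply, norm_fourier_apply, Complex.norm_real,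
      Real.norm_of_nonneg (heatMultiplier_pos τ n).le, mul_one, mul_one]
  have ha : 0 < ((4 * Real.pi * τ : ℝ) : ℂ).re := by rw [Complex.ofReal_re]; positivity
  -- Poisson summation for a Gaussian with parameter `4πτ`; the imaginary shift turns the dual side
  -- into the sum over translates `x - z + n`.
  have h := Complex.tsum_exp_neg_quadratic ha (-Complex.I * ((x - z : ℝ) : ℂ))
  have hpi : (Real.pi : ℂ) ≠ 0 := by exact_mod_cast Real.pi_ne_zero
  have hτ' : (τ : ℂ) ≠ 0 := by exact_mod_cast hτ.ne'
  have hroot : ((4 * Real.pi * τ : ℝ) : ℂ) ^ (1 / 2 : ℂ) = (√(4 * Real.pi * τ) : ℝ) := by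
    rw [Real.sqrt_eq_rpow, Complex.ofReal_cpow (by positivity)]
    simp
  convert! hs.hasSum using 1
  calc (periodicHeatKernel τ (x - z) : ℂ)
      = 1 / ((4 * Real.pi * τ : ℝ) : ℂ) ^ (1 / 2 : ℂ) * ∑' n : ℤ,
          Complex.exp (-Real.pi / ((4 * Real.pi * τ : ℝ) : ℂ) *
            (n + Complex.I * (-Complex.I * ((x - z : ℝ) : ℂ))) ^ 2) := by
        rw [periodicHeatKernel, hroot, ← tsum_mul_left, Complex.ofReal_tsum]
        refine tsum_congr fun n => ?_
        rw [heatKernel]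
        push_cast
        congr 2
        have : (n + Complex.I * (-Complex.I * ((x : ℂ) - z))) = x - z + n := by
          linear_combination (-((x : ℂ) - z)) * Complex.I_sq
        rw [this]
        field_simp
    _ = _ := by
        rw [← h]
        refine tsum_congr fun n => ?_
        rw [fourier_coe_apply, fourier_coe_apply, heatMultiplier, Complex.ofReal_exp,
          ← Complex.exp_add, ← Complex.exp_add]
        congr 1
        push_cast
        ring

/-- Parseval's identity for an absolutely convergent Fourier series. -/
lemma lintegral_enorm_sq_of_hasSum_fourier {c : ℤ → ℂ} (hc : Summable fun n => ‖c n‖)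
    {F : ℝ → ℂ} (hF : ∀ z : ℝ, HasSum (fun n => c n * fourier n (z : UnitAddCircle)) (F z)) :
    ∫⁻ z in Set.Icc (0 : ℝ) 1, ‖F z‖ₑ ^ 2 = ∑' n, ‖c n‖ₑ ^ 2 := by
  have hs : Summable fun n => c n • (fourier n : C(UnitAddCircle, ℂ)) := by
    refine Summable.of_norm ?_
    simpa only [norm_smul, fourier_norm, mul_one] using hc
  set g : C(UnitAddCircle, ℂ) := ∑' n, c n • (fourier n : C(UnitAddCircle, ℂ))
  have hg : HasSum (fun n => c n • (fourier n : C(UnitAddCircle, ℂ))) g := hs.hasSum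
  have hFg : ∀ z : ℝ, F z = g z := fun z =>
    (hF z).unique (by simpa using (ContinuousMap.evalCLM ℂ (z : UnitAddCircle)).hasSum hg)
  set G := ContinuousMap.toLp (E := ℂ) 2 (@AddCircle.haarAddCircle 1 _) ℂ g
  -- Absolute convergence gives uniform, hence `L²`, convergence, so the coefficients can be read
  -- off by orthonormality.
  have hcoeff : ∀ n, fourierCoeff G n = c n := fun n => by
    have h1 : HasSum (fun k => c k • fourierLp (T := 1) 2 k) G := by
      simpa [fourierLp] using
        (ContinuousMap.toLp (E := ℂ) 2 (@AddCircle.haarAddCircle 1 _) ℂ).hasSum hg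
    have h2 := (innerSL ℂ (fourierBasis (T := 1) n)).hasSum h1
    rw [← fourierBasis_repr, HilbertBasis.repr_apply_apply]
    refine (h2.unique ?_)
    have horth := orthonormal_iff_ite.1 (fourierBasis (T := 1)).orthonormal n
    convert! hasSum_single (f := fun k => inner ℂ (fourierBasis (T := 1) n)
      (c k • fourierLp (T := 1) 2 k)) n fun k hk => ?_ using 1
    · rw [← coe_fourierBasis, inner_smul_right, horth, if_pos rfl, mul_one]
    · rw [← coe_fourierBasis, inner_smul_right, horth, if_neg hk.symm, mul_zero]
  have h := (hasSum_sq_fourierCoeff G)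
  simp_rw [hcoeff] at h
  have hvol : (volume : Measure UnitAddCircle) = AddCircle.haarAddCircle := by
    rw [AddCircle.volume_eq_smul_haarAddCircle]; simp
  calc ∫⁻ z in Set.Icc (0 : ℝ) 1, ‖F z‖ₑ ^ 2
      = ∫⁻ z in Set.Ioc (0 : ℝ) (0 + 1), ‖g z‖ₑ ^ 2 := by
        simp_rw [hFg, zero_add]
        exact setLIntegral_congr Ioc_ae_eq_Icc.symm
    _ = ∫⁻ z, ‖g z‖ₑ ^ 2 ∂(@AddCircle.haarAddCircle 1 _) := by
        rw [UnitAddCircle.lintegral_preimage 0 (fun z => ‖g z‖ₑ ^ 2), hvol]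
    _ = ENNReal.ofReal (∫ z, ‖g z‖ ^ 2 ∂(@AddCircle.haarAddCircle 1 _)) := by
        rw [ofReal_integral_eq_lintegral_ofReal]
        · refine lintegral_congr fun z => ?_
          rw [ENNReal.ofReal_pow (norm_nonneg _), ofReal_norm]
        · exact (Continuous.integrable_of_hasCompactSupport (by fun_prop)
            (HasCompactSupport.of_compactSpace _))
        · exact Filter.Eventually.of_forall fun z => by positivity
    _ = ENNReal.ofReal (∑' n, ‖c n‖ ^ 2) := by
        rw [h.tsum_eq]
        congr 1
        refine integral_congr_ae ?_
        filter_upwards [ContinuousMap.coeFn_toLp (E := ℂ) (p := 2) (𝕜 := ℂ)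
          (@AddCircle.haarAddCircle 1 _) g] with z hz
        rw [hz]
    _ = _ := by
        rw [ENNReal.ofReal_tsum_of_nonneg (fun n => by positivity) h.summable]
        refine tsum_congr fun n => ?_
        rw [ENNReal.ofReal_pow (norm_nonneg _), ofReal_norm]

/-- `Σ_x a_x e^{-2πinx}` for a finitely supported measure `Σ_x a_x δ_x`. -/
def fourierWeight (n : ℤ) : (Set.Icc (0 : ℝ) 1 →₀ ℝ) →ₗ[ℝ] ℂ :=
  Finsupp.linearCombination ℝ fun x => (fourier (-n) ((x : ℝ) : UnitAddCircle) : ℂ)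

/-- The combination `Σ_x a_x K_{t,x}` of the integrands of the stochastic convolution. -/
def duhamelCombination (t : ℝ) : (Set.Icc (0 : ℝ) 1 →₀ ℝ) →ₗ[ℝ] (ℝ × ℝ → ℝ) :=
  Finsupp.linearCombination ℝ fun x => duhamelKernel t x

lemma norm_fourierWeight_le (n : ℤ) (a : Set.Icc (0 : ℝ) 1 →₀ ℝ) :
    ‖fourierWeight n a‖ ≤ a.sum fun _ r => |r| := by
  rw [fourierWeight, Finsupp.linearCombination_apply, Finsupp.sum]
  refine (norm_sum_le _ _).trans (Finset.sum_le_sum fun x _ => ?_)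
  rw [norm_smul, norm_fourier_apply, mul_one, Real.norm_eq_abs]

lemma hasSum_duhamelCombination {t s : ℝ} (hst : s < t) (a : Set.Icc (0 : ℝ) 1 →₀ ℝ) (z : ℝ) :
    HasSum (fun n : ℤ => (heatMultiplier (t - s) n * fourierWeight n a) *
      fourier n (z : UnitAddCircle)) (duhamelCombination t a (s, z) : ℂ) := by
  induction a using Finsupp.induction_linear with
  | zero => simp
  | add a b ha hb =>
    simp only [map_add, Pi.add_apply, Complex.ofReal_add, mul_add, add_mul]
    exact ha.add hb
  | single x r =>
    have := (hasSum_periodicHeatKernel (sub_pos.2 hst) x z).mul_left (r : ℂ)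
    convert! this using 1
    · ext n
      simp only [fourierWeight, Finsupp.linearCombination_single, Complex.real_smul]
      ring
    · simp [duhamelCombination, duhamelKernel, hst]

/-- Parseval in space at a fixed time. It applies because the multipliers are summable for `s < t`
and the weights are bounded in `n`. -/
lemma lintegral_enorm_sq_duhamelCombination_slice {t s : ℝ} (hst : s < t)
    (a : Set.Icc (0 : ℝ) 1 →₀ ℝ) :
    ∫⁻ z in Set.Icc (0 : ℝ) 1, ‖duhamelCombination t a (s, z)‖ₑ ^ 2 =
      ∑' n : ℤ, ENNReal.ofReal (heatMultiplier (t - s) n ^ 2) * ‖fourierWeight n a‖ₑ ^ 2 := by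
  have hsum : Summable fun n : ℤ => ‖(heatMultiplier (t - s) n * fourierWeight n a : ℂ)‖ := by
    refine Summable.of_nonneg_of_le (fun _ => norm_nonneg _) (fun n => ?_)
      ((summable_heatMultiplier (sub_pos.2 hst)).mul_right (a.sum fun _ r => |r|))
    rw [norm_mul, Complex.norm_real, Real.norm_of_nonneg (heatMultiplier_pos _ _).le]
    exact mul_le_mul_of_nonneg_left (norm_fourierWeight_le n a) (heatMultiplier_pos _ _).le
  have h := lintegral_enorm_sq_of_hasSum_fourier hsum (hasSum_duhamelCombination hst a)
  have hreal : ∀ r : ℝ, ‖(r : ℂ)‖ₑ = ‖r‖ₑ := fun r => by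
    rw [← ofReal_norm, Complex.norm_real, ofReal_norm]
  simp_rw [hreal] at h
  rw [h]
  refine tsum_congr fun n => ?_
  rw [enorm_mul, hreal, mul_pow, ENNReal.ofReal_pow (heatMultiplier_pos _ _).le,
    Real.enorm_of_nonneg (heatMultiplier_pos _ _).le]

/-- `∫_0^t e^{-8π²n²(t-s)} ds`, an upper bound for the variance of the `n`-th Fourier mode. -/
lemma lintegral_heatMultiplier_sq_le {t : ℝ} (ht : 0 ≤ t) {n : ℤ} (hn : n ≠ 0) :
    ∫⁻ s in Set.Ico 0 t, ENNReal.ofReal (heatMultiplier (t - s) n ^ 2) ≤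
      ENNReal.ofReal (1 / (8 * Real.pi ^ 2 * n ^ 2)) := by
  have hn' : (n : ℝ) ≠ 0 := by exact_mod_cast hn
  set c : ℝ := 8 * Real.pi ^ 2 * n ^ 2
  have hc : 0 < c := by positivity
  have hfun : ∀ s, heatMultiplier (t - s) n ^ 2 = Real.exp (-c * (t - s)) := fun s => by
    rw [heatMultiplier, ← Real.exp_nat_mul]
    congr 1; push_cast; ring
  simp_rw [hfun]
  have hcont : Continuous fun s => Real.exp (-c * (t - s)) := by fun_prop
  rw [← ofReal_integral_eq_lintegral_ofReal
    (hcont.integrableOn_Icc.mono_set Set.Ico_subset_Icc_self)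
    (Filter.Eventually.of_forall fun _ => (Real.exp_pos _).le)]
  refine ENNReal.ofReal_le_ofReal ?_
  rw [integral_Ico_eq_integral_Ioc, ← intervalIntegral.integral_of_le ht]
  have hderiv : ∀ s ∈ Set.uIcc 0 t,
      HasDerivAt (fun s => Real.exp (-c * (t - s)) / c) (Real.exp (-c * (t - s))) s := fun s _ => by
    have h1 : HasDerivAt (fun s => -c * (t - s)) c s := by
      simpa using ((hasDerivAt_id s).const_sub t).const_mul (-c)
    convert! h1.exp.div_const c using 1
    field_simp
  rw [intervalIntegral.integral_eq_sub_of_hasDerivAt hderiv (hcont.intervalIntegrable _ _)]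
  simp only [sub_self, mul_zero, Real.exp_zero]
  have : 0 < Real.exp (-c * (t - 0)) / c := by positivity
  linarith

lemma lintegral_heatMultiplier_zero_sq {t : ℝ} :
    ∫⁻ s in Set.Ico 0 t, ENNReal.ofReal (heatMultiplier (t - s) 0 ^ 2) = ENNReal.ofReal t := by
  simp [heatMultiplier]

/-- Integrating the slice identity over time diagonalises the covariance in Fourier modes; times `s
≥ t` contribute nothing. -/
lemma lintegral_enorm_sq_duhamelCombination {T : ℝ} (t : Set.Icc (0 : ℝ) T)
    (a : Set.Icc (0 : ℝ) 1 →₀ ℝ)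
    (hmeas : AEStronglyMeasurable (duhamelCombination t a) (spaceTimeMeasure T)) :
    ∫⁻ p, ‖duhamelCombination t a p‖ₑ ^ 2 ∂spaceTimeMeasure T =
      ∑' n : ℤ, (∫⁻ s in Set.Ico 0 (t : ℝ), ENNReal.ofReal (heatMultiplier (t - s) n ^ 2)) *
        ‖fourierWeight n a‖ₑ ^ 2 := by
  have hzero : ∀ s z, ¬ s < (t : ℝ) → duhamelCombination t a (s, z) = 0 := fun s z hs => by
    rw [duhamelCombination, Finsupp.linearCombination_apply, Finsupp.sum, Finset.sum_apply]
    exact Finset.sum_eq_zero fun x _ => by simp [duhamelKernel, hs]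
  have hcm : ∀ n, Measurable fun s : ℝ => ENNReal.ofReal (heatMultiplier (t - s) n ^ 2) :=
    fun n => Measurable.ennreal_ofReal (Continuous.measurable (by unfold heatMultiplier; fun_prop))
  rw [spaceTimeMeasure, lintegral_prod _ (hmeas.enorm.pow_const 2)]
  have hind : ∀ s, ∫⁻ z in Set.Icc (0 : ℝ) 1, ‖duhamelCombination t a (s, z)‖ₑ ^ 2 =
      (Set.Iio (t : ℝ)).indicator (fun s => ∑' n : ℤ,
        ENNReal.ofReal (heatMultiplier (t - s) n ^ 2) * ‖fourierWeight n a‖ₑ ^ 2) s := fun s => by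
    by_cases hs : s < (t : ℝ)
    · rw [Set.indicator_of_mem (show s ∈ Set.Iio (t : ℝ) from hs),
        lintegral_enorm_sq_duhamelCombination_slice hs]
    · rw [Set.indicator_of_notMem (by simpa using hs)]
      simp [hzero s _ hs]
  simp_rw [hind]
  rw [lintegral_indicator measurableSet_Iio, Measure.restrict_restrict measurableSet_Iio]
  have hset : Set.Iio (t : ℝ) ∩ Set.Icc 0 T = Set.Ico 0 (t : ℝ) := by
    ext s
    constructor
    · rintro ⟨h1, h2⟩; exact ⟨h2.1, h1⟩
    · rintro ⟨h1, h2⟩; exact ⟨h2, h1, h2.le.trans t.2.2⟩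
  rw [hset, lintegral_tsum fun n => ((hcm n).mul_const _).aemeasurable]
  exact tsum_congr fun n => lintegral_mul_const _ (hcm n)

end HeatFourier

/-! ### Variance bounds for increments and point values. -/

section HeatBounds

/-- Parseval for general `L²` functions: it will be applied to step functions, whose Fourier series
need not converge absolutely. -/
lemma tsum_enorm_sq_integral_exp_mul {f : ℝ → ℂ}
    (hf : MemLp f 2 (volume.restrict (Set.Ioc (0 : ℝ) 1))) :
    ∑' n : ℤ, ‖∫ z in (0 : ℝ)..1, Complex.exp (-(2 * Real.pi * Complex.I * n) * z) * f z‖ₑ ^ 2 =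
      ENNReal.ofReal (∫ z in (0 : ℝ)..1, ‖f z‖ ^ 2) := by
  have h := hasSum_sq_fourierCoeffOn zero_lt_one hf
  simp only [sub_zero, inv_one, one_smul] at h
  rw [← h.tsum_eq, ENNReal.ofReal_tsum_of_nonneg (fun n => by positivity) h.summable]
  refine tsum_congr fun n => ?_
  rw [ENNReal.ofReal_pow (norm_nonneg _), ofReal_norm, fourierCoeffOn_eq_integral]
  simp only [sub_zero, div_one, one_smul, fourier_coe_apply, smul_eq_mul]
  congr 3
  simp

/-- The signed measure `Σ_j b_j (δ_{u_{j+1}} - δ_{u_j})`. -/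
def incrementWeight (u : ℕ → Set.Icc (0 : ℝ) 1) (b : ℕ → ℝ) (N : ℕ) : Set.Icc (0 : ℝ) 1 →₀ ℝ :=
  ∑ j ∈ Finset.range N, b j • (Finsupp.single (u (j + 1)) 1 - Finsupp.single (u j) 1)

/-- The step function with value `b_j` on `(u_j, u_{j+1}]`. -/
def stepFunction (u : ℕ → Set.Icc (0 : ℝ) 1) (b : ℕ → ℝ) (N : ℕ) (z : ℝ) : ℝ :=
  ∑ j ∈ Finset.range N, (Set.Ioc (u j : ℝ) (u (j + 1))).indicator (fun _ => b j) z

/-- Kept general in `g` so as to serve both for characters and for coordinates of the path `h(t,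
·)`. -/
lemma linearCombination_incrementWeight {M : Type*} [AddCommGroup M] [Module ℝ M]
    (g : Set.Icc (0 : ℝ) 1 → M) (u : ℕ → Set.Icc (0 : ℝ) 1) (b : ℕ → ℝ) (N : ℕ) :
    Finsupp.linearCombination ℝ g (incrementWeight u b N) =
      ∑ j ∈ Finset.range N, b j • (g (u (j + 1)) - g (u j)) := by
  simp [incrementWeight, Finsupp.linearCombination_single]

lemma measurable_stepFunction (u : ℕ → Set.Icc (0 : ℝ) 1) (b : ℕ → ℝ) (N : ℕ) :
    Measurable (stepFunction u b N) := by
  unfold stepFunction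
  exact Finset.measurable_fun_sum _ fun j _ => measurable_const.indicator measurableSet_Ioc

/-- Monotonicity of `u` makes the intervals disjoint, so there are no cross terms. -/
lemma stepFunction_sq {u : ℕ → Set.Icc (0 : ℝ) 1} (hu : Monotone u) (b : ℕ → ℝ) (N : ℕ) (z : ℝ) :
    stepFunction u b N z ^ 2 = ∑ j ∈ Finset.range N,
      (Set.Ioc (u j : ℝ) (u (j + 1))).indicator (fun _ => b j ^ 2) z := by
  have hdisj : ∀ i j, i ≠ j → z ∈ Set.Ioc (u i : ℝ) (u (i + 1)) →
      z ∉ Set.Ioc (u j : ℝ) (u (j + 1)) := fun i j hij hi hj =>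
    Set.disjoint_left.1 (Monotone.pairwise_disjoint_on_Ioc_succ
      (f := fun j => (u j : ℝ)) (fun i j h => hu h) hij) hi hj
  by_cases h : ∃ j ∈ Finset.range N, z ∈ Set.Ioc (u j : ℝ) (u (j + 1))
  · obtain ⟨j, hj, hz⟩ := h
    rw [stepFunction, Finset.sum_eq_single_of_mem j hj, Finset.sum_eq_single_of_mem j hj,
      Set.indicator_of_mem hz, Set.indicator_of_mem hz]
    · exact fun k _ hk => Set.indicator_of_notMem (hdisj j k hk.symm hz) _
    · exact fun k _ hk => Set.indicator_of_notMem (hdisj j k hk.symm hz) _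
  · push Not at h
    rw [stepFunction, Finset.sum_eq_zero fun j hj => Set.indicator_of_notMem (h j hj) _,
      Finset.sum_eq_zero fun j hj => Set.indicator_of_notMem (h j hj) _]
    simp

lemma intervalIntegral_mul_indicator_Ioc {g : ℝ → ℂ} (c : ℂ) {x y : ℝ} (hx : 0 ≤ x) (hxy : x ≤ y)
    (hy : y ≤ 1) :
    ∫ z in (0 : ℝ)..1, g z * (Set.Ioc x y).indicator (fun _ => c) z = c * ∫ z in x..y, g z := by
  have h : ∀ z, g z * (Set.Ioc x y).indicator (fun _ => c) z =
      (Set.Ioc x y).indicator (fun z => c * g z) z := fun z => by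
    by_cases hz : z ∈ Set.Ioc x y <;> simp [hz, mul_comm]
  simp_rw [h]
  rw [intervalIntegral.integral_of_le zero_le_one, integral_indicator measurableSet_Ioc,
    Measure.restrict_restrict measurableSet_Ioc,
    Set.inter_eq_left.2 (Set.Ioc_subset_Ioc hx hy), integral_const_mul,
    intervalIntegral.integral_of_le hxy]

/-- The measure is minus the distributional derivative of the step function. Concretely, each
difference of a character is the integral of its derivative over one interval. -/
lemma fourierWeight_incrementWeight {n : ℤ} (hn : n ≠ 0) {u : ℕ → Set.Icc (0 : ℝ) 1}
    (hu : Monotone u) (b : ℕ → ℝ) (N : ℕ) :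
    fourierWeight n (incrementWeight u b N) = -(2 * Real.pi * Complex.I * n) *
      ∫ z in (0 : ℝ)..1, Complex.exp (-(2 * Real.pi * Complex.I * n) * z) *
        (stepFunction u b N z : ℂ) := by
  set c : ℂ := -(2 * Real.pi * Complex.I * n)
  have hc : c ≠ 0 := by
    simp [c, hn, Real.pi_ne_zero]
  have hcont : Continuous fun z : ℝ => Complex.exp (c * z) := by fun_prop
  have hcast : ∀ z, (stepFunction u b N z : ℂ) = ∑ j ∈ Finset.range N,
      (Set.Ioc (u j : ℝ) (u (j + 1))).indicator (fun _ => (b j : ℂ)) z := fun z => by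
    rw [stepFunction, Complex.ofReal_sum]
    refine Finset.sum_congr rfl fun j _ => ?_
    by_cases hz : z ∈ Set.Ioc (u j : ℝ) (u (j + 1)) <;> simp [hz]
  simp_rw [hcast, Finset.mul_sum]
  rw [intervalIntegral.integral_finsetSum, fourierWeight, linearCombination_incrementWeight,
    Finset.mul_sum]
  · refine Finset.sum_congr rfl fun j _ => ?_
    rw [intervalIntegral_mul_indicator_Ioc _ (u j).2.1 (hu j.le_succ) (u (j + 1)).2.2,
      integral_exp_mul_complex hc, Complex.real_smul, fourier_coe_apply, fourier_coe_apply]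
    have he : ∀ x : ℝ, 2 * Real.pi * Complex.I * ((-n : ℤ) : ℂ) * x / ((1 : ℝ) : ℂ) = c * x :=
      fun x => by simp [c]
    rw [he, he]
    field_simp
  · intro j _
    rw [intervalIntegrable_iff_integrableOn_Ioc_of_le zero_le_one]
    have h1 : IntegrableOn (fun z : ℝ => Complex.exp (c * z) * (b j : ℂ)) (Set.Ioc 0 1) :=
      (Continuous.integrableOn_Icc (by fun_prop)).mono_set Set.Ioc_subset_Icc_self
    refine (h1.indicator (measurableSet_Ioc (a := (u j : ℝ)) (b := u (j + 1)))).congr ?_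
    refine Filter.Eventually.of_forall fun z => ?_
    by_cases hz : z ∈ Set.Ioc (u j : ℝ) (u (j + 1)) <;> simp [hz]

lemma integral_stepFunction_sq {u : ℕ → Set.Icc (0 : ℝ) 1} (hu : Monotone u) (b : ℕ → ℝ) (N : ℕ) :
    ∫ z in (0 : ℝ)..1, stepFunction u b N z ^ 2 =
      ∑ j ∈ Finset.range N, b j ^ 2 * ((u (j + 1) : ℝ) - u j) := by
  simp_rw [stepFunction_sq hu]
  rw [intervalIntegral.integral_of_le zero_le_one, integral_finsetSum]
  · refine Finset.sum_congr rfl fun j _ => ?_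
    rw [integral_indicator measurableSet_Ioc, Measure.restrict_restrict measurableSet_Ioc,
      Set.inter_eq_left.2 (Set.Ioc_subset_Ioc (u j).2.1 (u (j + 1)).2.2), setIntegral_const,
      Real.volume_real_Ioc_of_le (hu j.le_succ), smul_eq_mul, mul_comm]
  · exact fun j _ => (integrable_const _).indicator measurableSet_Ioc

/-- The variance of a linear combination of increments is at most half the squared `L²` norm of
the associated step function. -/
lemma lintegral_enorm_sq_duhamelCombination_incrementWeight_le {T : ℝ} (t : Set.Icc (0 : ℝ) T)
    {u : ℕ → Set.Icc (0 : ℝ) 1} (hu : Monotone u) (b : ℕ → ℝ) (N : ℕ)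
    (hmeas : AEStronglyMeasurable (duhamelCombination t (incrementWeight u b N))
      (spaceTimeMeasure T)) :
    ∫⁻ p, ‖duhamelCombination t (incrementWeight u b N) p‖ₑ ^ 2 ∂spaceTimeMeasure T ≤
      ENNReal.ofReal (1 / 2 * ∑ j ∈ Finset.range N, b j ^ 2 * ((u (j + 1) : ℝ) - u j)) := by
  rw [lintegral_enorm_sq_duhamelCombination t _ hmeas]
  have hmem : MemLp (fun z => (stepFunction u b N z : ℂ)) 2
      (volume.restrict (Set.Ioc (0 : ℝ) 1)) := by
    refine MemLp.of_bound (C := ∑ j ∈ Finset.range N, |b j|)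
      (Complex.measurable_ofReal.comp (measurable_stepFunction u b N)).aestronglyMeasurable
      (Filter.Eventually.of_forall fun z => ?_)
    rw [Complex.norm_real, stepFunction]
    refine (norm_sum_le _ _).trans (Finset.sum_le_sum fun j _ => ?_)
    exact norm_indicator_le_norm_self (fun _ => b j) z
  have hpars := tsum_enorm_sq_integral_exp_mul hmem
  simp only [Complex.norm_real, Real.norm_eq_abs, sq_abs] at hpars
  rw [integral_stepFunction_sq hu] at hpars
  rw [ENNReal.ofReal_mul (by norm_num), ← hpars, ← ENNReal.tsum_mul_left]
  refine ENNReal.tsum_le_tsum fun n => ?_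
  -- The zero mode, the only one without decay in time, is absent because increments have total mass
  -- `0`.
  by_cases hn : n = 0
  · subst hn
    have : fourierWeight 0 (incrementWeight u b N) = 0 := by
      rw [fourierWeight, linearCombination_incrementWeight]
      simp
    simp [this]
  have hn' : (n : ℝ) ≠ 0 := by exact_mod_cast hn
  rw [fourierWeight_incrementWeight hn hu, enorm_mul, mul_pow, ← mul_assoc]
  gcongr
  have hnorm : ‖-(2 * Real.pi * Complex.I * n)‖ₑ ^ 2 =
      ENNReal.ofReal (4 * Real.pi ^ 2 * n ^ 2) := by
    rw [← ofReal_norm, ← ENNReal.ofReal_pow (norm_nonneg _)]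
    congr 1
    simp only [norm_neg, norm_mul, Complex.norm_I, Complex.norm_real, Complex.norm_intCast,
      Complex.norm_ofNat, mul_one, mul_pow, Real.norm_eq_abs, sq_abs]
    norm_num
  rw [hnorm]
  -- The factor `n²` from the derivative cancels the smoothing exactly: `4π²n² / (8π²n²) = 1/2`.
  refine (mul_le_mul_left (lintegral_heatMultiplier_sq_le t.2.1 hn) _).trans (le_of_eq ?_)
  rw [← ENNReal.ofReal_mul (by positivity)]
  congr 1
  have := Real.pi_ne_zero
  field_simp
  norm_num

/-- The variance of the value at a point is bounded uniformly in time. -/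
lemma exists_lintegral_enorm_sq_duhamelKernel_le (T : ℝ) :
    ∃ K : ℝ, 0 < K ∧ ∀ (t : Set.Icc (0 : ℝ) T) (x : Set.Icc (0 : ℝ) 1) (r : ℝ),
      AEStronglyMeasurable (duhamelCombination t (Finsupp.single x r)) (spaceTimeMeasure T) →
      ∫⁻ p, ‖duhamelCombination t (Finsupp.single x r) p‖ₑ ^ 2 ∂spaceTimeMeasure T ≤
        ENNReal.ofReal (K * r ^ 2) := by
  have hs : Summable fun n : ℤ => 1 / (8 * Real.pi ^ 2 * (n : ℝ) ^ 2) := by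
    refine ((Real.summable_one_div_int_pow.2 one_lt_two).mul_left (1 / (8 * Real.pi ^ 2))).congr
      fun n => ?_
    rw [div_mul_div_comm, one_mul]
  set S := ∑' n : ℤ, 1 / (8 * Real.pi ^ 2 * (n : ℝ) ^ 2)
  have hS : 0 ≤ S := tsum_nonneg fun n => by positivity
  -- `|T|` bounds the zero mode and `S` the others (its term at `n = 0` is `1 / 0 = 0`); the `1`
  -- ensures positivity.
  refine ⟨|T| + S + 1, by positivity, fun t x r hmeas => ?_⟩
  rw [lintegral_enorm_sq_duhamelCombination t _ hmeas]
  have hw : ∀ n, ‖fourierWeight n (Finsupp.single x r)‖ₑ ^ 2 = ENNReal.ofReal (r ^ 2) := fun n => by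
    rw [fourierWeight, Finsupp.linearCombination_single, ← ofReal_norm,
      ← ENNReal.ofReal_pow (norm_nonneg _), norm_smul, norm_fourier_apply, mul_one,
      Real.norm_eq_abs, sq_abs]
  simp_rw [hw]
  rw [ENNReal.tsum_mul_right, ENNReal.ofReal_mul (by positivity)]
  gcongr
  calc ∑' n : ℤ, ∫⁻ s in Set.Ico 0 (t : ℝ), ENNReal.ofReal (heatMultiplier (t - s) n ^ 2)
      ≤ ∑' n : ℤ, ((if n = 0 then ENNReal.ofReal |T| else 0) +
          ENNReal.ofReal (1 / (8 * Real.pi ^ 2 * (n : ℝ) ^ 2))) := by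
        refine ENNReal.tsum_le_tsum fun n => ?_
        by_cases hn : n = 0
        · subst hn
          rw [lintegral_heatMultiplier_zero_sq, if_pos rfl]
          exact (ENNReal.ofReal_le_ofReal (t.2.2.trans (le_abs_self T))).trans le_self_add
        · rw [if_neg hn, zero_add]
          exact lintegral_heatMultiplier_sq_le t.2.1 hn
    _ = ENNReal.ofReal |T| + ENNReal.ofReal S := by
        rw [ENNReal.tsum_add, tsum_ite_eq, ENNReal.ofReal_tsum_of_nonneg
          (fun n => by positivity) hs]
    _ ≤ _ := by
        rw [← ENNReal.ofReal_add (abs_nonneg T) hS]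
        exact ENNReal.ofReal_le_ofReal (by linarith)

end HeatBounds

/-! ### Duality and evaluation functionals. -/

section CameronMartin

/-- Homogeneity: `ℓ / √v` is admissible in the supremum. -/
lemma ofReal_apply_le_cameronMartinNorm {E : Type*} [NormedAddCommGroup E] [NormedSpace ℝ E]
    [MeasurableSpace E] {μ : Measure E} (ℓ : StrongDual ℝ E) {v : ℝ} (hv : 0 < v)
    (hℓ : evariance ℓ μ ≤ ENNReal.ofReal v) (h : E) :
    ENNReal.ofReal (ℓ h) ≤ ENNReal.ofReal √v * cameronMartinNorm μ h := by
  have hsv : 0 < √v := Real.sqrt_pos.2 hv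
  have h1 : evariance ((√v)⁻¹ • ℓ : StrongDual ℝ E) μ ≤ 1 := by
    have : ⇑((√v)⁻¹ • ℓ : StrongDual ℝ E) = fun x => (√v)⁻¹ * ℓ x := rfl
    rw [this, evariance_mul, inv_pow, Real.sq_sqrt hv.le]
    calc ENNReal.ofReal v⁻¹ * evariance ℓ μ ≤ ENNReal.ofReal v⁻¹ * ENNReal.ofReal v := by gcongr
      _ = 1 := by rw [← ENNReal.ofReal_mul (by positivity), inv_mul_cancel₀ hv.ne',
        ENNReal.ofReal_one]
  have h2 : ENNReal.ofReal (((√v)⁻¹ • ℓ : StrongDual ℝ E) h) ≤ cameronMartinNorm μ h :=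
    le_iSup₂_of_le ((√v)⁻¹ • ℓ : StrongDual ℝ E) h1 le_rfl
  calc ENNReal.ofReal (ℓ h)
      = ENNReal.ofReal √v * ENNReal.ofReal (((√v)⁻¹ • ℓ : StrongDual ℝ E) h) := by
        rw [← ENNReal.ofReal_mul hsv.le, _root_.smul_apply, smul_eq_mul,
          mul_inv_cancel_left₀ hsv.ne']
    _ ≤ _ := by gcongr

end CameronMartin

namespace SheetSpace

variable {T α β m : ℝ} [Fact (0 < T)] [Fact (1 ≤ m)] {d : ℕ}

/-- The continuous functional `f ↦ f^i(t, x)` on the sheet space. -/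
def evalCLM (hα : 1 / m < α) (hβ : 1 / m < β) (t : Set.Icc (0 : ℝ) T) (i : Fin d)
    (x : Set.Icc (0 : ℝ) 1) : StrongDual ℝ (SheetSpace T α β m d) :=
  (EuclideanSpace.proj i).comp
    ((⟨BesovPath.evalₗ α m _ x, BesovPath.continuous_evalₗ hα x⟩ :
      BesovPath 1 α m (EuclideanSpace ℝ (Fin d)) →L[ℝ] EuclideanSpace ℝ (Fin d)).comp
    ((⟨BesovPath.evalₗ β m _ t, BesovPath.continuous_evalₗ hβ t⟩ :
      BesovPath T β m (BesovPath 1 α m (EuclideanSpace ℝ (Fin d))) →L[ℝ] _).comp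
    (BesovPath.startZero T β m (BesovPath 1 α m (EuclideanSpace ℝ (Fin d)))).subtypeL))

/-- The continuous functional `f ↦ Σ_i Σ_x a^i_x f^i(t, x)` on the sheet space. -/
def combination (hα : 1 / m < α) (hβ : 1 / m < β) (t : Set.Icc (0 : ℝ) T)
    (a : Fin d → Set.Icc (0 : ℝ) 1 →₀ ℝ) : StrongDual ℝ (SheetSpace T α β m d) :=
  ∑ i, Finsupp.linearCombination ℝ (evalCLM hα hβ t i) (a i)

lemma combination_apply (hα : 1 / m < α) (hβ : 1 / m < β) (t : Set.Icc (0 : ℝ) T)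
    (a : Fin d → Set.Icc (0 : ℝ) 1 →₀ ℝ) (f : SheetSpace T α β m d) :
    combination hα hβ t a f =
      ∑ i, Finsupp.linearCombination ℝ (fun x => f.slice t x i) (a i) := by
  rw [combination, _root_.sum_apply]
  refine Finset.sum_congr rfl fun i _ => ?_
  rw [Finsupp.linearCombination_apply, Finsupp.linearCombination_apply, Finsupp.sum, Finsupp.sum,
    _root_.sum_apply]
  rfl

end SheetSpace

/-! ### Variances under the law of the heat sheet, and the resulting path bounds. -/

namespace IsStochasticHeatSheet

variable {Ω : Type*} [MeasurableSpace Ω] {T α β m : ℝ} [Fact (0 < T)]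
    [Fact (1 ≤ m)] {d : ℕ} {P : Measure Ω}
    {ξ : Fin d → Lp ℝ 2 (spaceTimeMeasure T) →ₗ[ℝ] Lp ℝ 2 P}
    {ψ : Ω → SheetSpace T α β m d}

/-- Square integrability is part of the mild formulation and is read off from any component, which
is why an index `i` is taken. -/
lemma memLp_duhamelKernel (hψ : IsStochasticHeatSheet P ξ ψ) (i : Fin d) (t : Set.Icc (0 : ℝ) T)
    (x : Set.Icc (0 : ℝ) 1) : MemLp (duhamelKernel t x) 2 (spaceTimeMeasure T) :=
  (hψ.mild t x i).1

lemma memLp_duhamelCombination (hψ : IsStochasticHeatSheet P ξ ψ) (i : Fin d)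
    (t : Set.Icc (0 : ℝ) T) (a : Set.Icc (0 : ℝ) 1 →₀ ℝ) :
    MemLp (duhamelCombination t a) 2 (spaceTimeMeasure T) := by
  induction a using Finsupp.induction_linear with
  | zero => simp
  | add a b ha hb => rw [map_add]; exact ha.add hb
  | single x r =>
    rw [duhamelCombination, Finsupp.linearCombination_single]
    exact (hψ.memLp_duhamelKernel i t x).const_smul r

/-- The mild formula holds almost surely at each point; linearity of `ξ i` extends it to finite
combinations. -/
lemma linearCombination_slice_ae_eq (hψ : IsStochasticHeatSheet P ξ ψ) (i : Fin d)
    (t : Set.Icc (0 : ℝ) T) (a : Set.Icc (0 : ℝ) 1 →₀ ℝ) :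
    (fun ω => Finsupp.linearCombination ℝ (fun x => (ψ ω).slice t x i) a) =ᵐ[P]
      ξ i ((hψ.memLp_duhamelCombination i t a).toLp _) := by
  induction a using Finsupp.induction_linear with
  | zero =>
    have hzero : ∀ {g : ℝ × ℝ → ℝ} (hg : MemLp g 2 (spaceTimeMeasure T)), g = 0 →
        hg.toLp g = 0 := by
      rintro _ hg rfl
      exact MemLp.toLp_zero hg
    rw [hzero _ (map_zero (duhamelCombination t)), map_zero]
    filter_upwards [Lp.coeFn_zero ℝ 2 P] with ω hω
    rw [hω, map_zero, Pi.zero_apply]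
  | add a b ha hb =>
    have : (hψ.memLp_duhamelCombination i t (a + b)).toLp _ =
        (hψ.memLp_duhamelCombination i t a).toLp _ +
          (hψ.memLp_duhamelCombination i t b).toLp _ := by
      rw [← MemLp.toLp_add]
      congr 1; rw [map_add]
    rw [this, map_add]
    simp only [map_add]
    exact (ha.add hb).trans (Lp.coeFn_add _ _).symm
  | single x r =>
    obtain ⟨hK, hx⟩ := hψ.mild t x i
    have : (hψ.memLp_duhamelCombination i t (Finsupp.single x r)).toLp _ = r • hK.toLp _ := by
      rw [← MemLp.toLp_const_smul]
      congr 1; rw [duhamelCombination, Finsupp.linearCombination_single]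
    rw [this, map_smul]
    simp only [Finsupp.linearCombination_single]
    exact (hx.const_smul r).trans (Lp.coeFn_smul _ _).symm

lemma variance_whiteNoise (hψ : IsStochasticHeatSheet P ξ ψ) (i : Fin d)
    (f : Lp ℝ 2 (spaceTimeMeasure T)) : Var[ξ i f; P] = ‖f‖ ^ 2 := by
  rw [(hψ.isWhiteNoise i f).variance_eq, variance_id_gaussianReal]
  simp

/-- The components are independent, so variances add, and each is a squared `L²` norm by the white
noise isometry. -/
lemma evariance_combination [IsProbabilityMeasure P] (hψ : IsStochasticHeatSheet P ξ ψ)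
    (hα : 1 / m < α) (hβ : 1 / m < β)
    (t : Set.Icc (0 : ℝ) T) (a : Fin d → Set.Icc (0 : ℝ) 1 →₀ ℝ) :
    evariance (SheetSpace.combination hα hβ t a) (P.map ψ) =
      ∑ i, ∫⁻ p, ‖duhamelCombination t (a i) p‖ₑ ^ 2 ∂spaceTimeMeasure T := by
  set ℓ := SheetSpace.combination (d := d) hα hβ t a
  set f : ∀ i : Fin d, Lp ℝ 2 (spaceTimeMeasure T) :=
    fun i => (hψ.memLp_duhamelCombination i t (a i)).toLp _
  have hℓm : AEStronglyMeasurable ℓ (P.map ψ) :=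
    ℓ.continuous.measurable.aestronglyMeasurable
  have hae : ℓ ∘ ψ =ᵐ[P] ∑ i, ⇑(ξ i (f i)) := by
    have := ae_all_iff.2 fun i => hψ.linearCombination_slice_ae_eq i t (a i)
    filter_upwards [this] with ω hω
    rw [Function.comp_apply, SheetSpace.combination_apply, Finset.sum_apply]
    exact Finset.sum_congr rfl fun i _ => hω i
  have hmem : MemLp (ℓ ∘ ψ) 2 P :=
    (memLp_congr_ae hae).2 (memLp_finsetSum' _ fun i _ => Lp.memLp _)
  have hind : iIndepFun (fun i => ⇑(ξ i (f i))) P :=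
    hψ.indep.comp (fun i F => F (f i)) fun i => measurable_pi_apply _
  have hprob : IsProbabilityMeasure (P.map ψ) := Measure.isProbabilityMeasure_map hψ.aemeasurable
  rw [← ofReal_variance ((memLp_map_measure_iff hℓm hψ.aemeasurable).2 hmem),
    variance_map hℓm.aemeasurable hψ.aemeasurable, variance_congr hae,
    IndepFun.variance_sum (fun i _ => Lp.memLp _) fun i _ j _ hij => hind.indepFun hij,
    ENNReal.ofReal_sum_of_nonneg fun i _ => variance_nonneg _ _]
  refine Finset.sum_congr rfl fun i _ => ?_
  rw [hψ.variance_whiteNoise, ENNReal.ofReal_pow (norm_nonneg _), Lp.norm_toLp,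
    ENNReal.ofReal_toReal (hψ.memLp_duhamelCombination i t (a i)).2.ne]
  have := eLpNorm_nnreal_pow_eq_lintegral (p := 2) (f := duhamelCombination t (a i))
    (μ := spaceTimeMeasure T) two_ne_zero
  simpa using this

/-- Cameron–Martin paths of the stochastic heat equation have finite variation. -/
lemma sum_enorm_slice_sub_le [IsProbabilityMeasure P] (hψ : IsStochasticHeatSheet P ξ ψ)
    (hα : 1 / m < α) (hβ : 1 / m < β) (h : SheetSpace T α β m d) (t : Set.Icc (0 : ℝ) T)
    {u : ℕ → Set.Icc (0 : ℝ) 1} (hu : Monotone u) (N : ℕ) {v : ℝ} (hv : 0 < v)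
    (huv : (u N : ℝ) - u 0 ≤ 2 * v) :
    ∑ j ∈ Finset.range N, ‖h.slice t (u (j + 1)) - h.slice t (u j)‖ₑ ≤
      ENNReal.ofReal √v * cameronMartinNorm (P.map ψ) h := by
  set w : ℕ → EuclideanSpace ℝ (Fin d) := fun j => h.slice t (u (j + 1)) - h.slice t (u j)
  -- Each increment is tested in its own direction `w j / ‖w j‖`, so the functional returns `Σ ‖w
  -- j‖` at `h`. If `w j = 0`, the convention `0⁻¹ = 0` gives weight `0`.
  set a : Fin d → Set.Icc (0 : ℝ) 1 →₀ ℝ :=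
    fun i => incrementWeight u (fun j => ‖w j‖⁻¹ * w j i) N
  have happ : SheetSpace.combination hα hβ t a h = ∑ j ∈ Finset.range N, ‖w j‖ := by
    rw [SheetSpace.combination_apply]
    simp_rw [a, linearCombination_incrementWeight]
    rw [Finset.sum_comm]
    refine Finset.sum_congr rfl fun j _ => ?_
    have hw : ∀ i, h.slice t (u (j + 1)) i - h.slice t (u j) i = w j i := fun i => rfl
    simp_rw [hw, smul_eq_mul, mul_assoc, ← sq]
    rw [← Finset.mul_sum, ← EuclideanSpace.real_norm_sq_eq]
    by_cases h0 : ‖w j‖ = 0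
    · simp [h0]
    · field_simp
  have hvar : evariance (SheetSpace.combination hα hβ t a) (P.map ψ) ≤ ENNReal.ofReal v := by
    rw [hψ.evariance_combination]
    refine (Finset.sum_le_sum fun i _ =>
      lintegral_enorm_sq_duhamelCombination_incrementWeight_le t hu _ N
        (hψ.memLp_duhamelCombination i t _).1).trans ?_
    have hincr : ∀ j, 0 ≤ (u (j + 1) : ℝ) - u j := fun j => sub_nonneg.2 (hu j.le_succ)
    rw [← ENNReal.ofReal_sum_of_nonneg fun i _ => mul_nonneg (by norm_num)
      (Finset.sum_nonneg fun j _ => mul_nonneg (sq_nonneg _) (hincr j)), ← Finset.mul_sum,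
      Finset.sum_comm]
    refine ENNReal.ofReal_le_ofReal ?_
    -- The coefficient vectors have norm at most `1`, so the squared `L²` norm of the step function
    -- telescopes to at most `u N - u 0`.
    have hle : ∀ j ∈ Finset.range N, ∑ i, (‖w j‖⁻¹ * w j i) ^ 2 * ((u (j + 1) : ℝ) - u j) ≤
        (u (j + 1) : ℝ) - u j := fun j _ => by
      rw [← Finset.sum_mul]
      refine mul_le_of_le_one_left (hincr j) ?_
      simp_rw [mul_pow]
      rw [← Finset.mul_sum, ← EuclideanSpace.real_norm_sq_eq, ← mul_pow]
      exact pow_le_one₀ (by positivity) inv_mul_le_one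
    have := Finset.sum_le_sum hle
    rw [Finset.sum_range_sub (fun j => (u j : ℝ))] at this
    linarith
  have hcm := ofReal_apply_le_cameronMartinNorm _ hv hvar h
  rw [happ, ENNReal.ofReal_sum_of_nonneg fun j _ => norm_nonneg _] at hcm
  simpa only [ofReal_norm] using hcm

/-- The same duality with a single point mass at `x` in the direction of `h(t, x)`. -/
lemma enorm_slice_le [IsProbabilityMeasure P] (hψ : IsStochasticHeatSheet P ξ ψ)
    (hα : 1 / m < α) (hβ : 1 / m < β) (h : SheetSpace T α β m d) (t : Set.Icc (0 : ℝ) T)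
    (x : Set.Icc (0 : ℝ) 1) {K : ℝ} (hK : 0 < K)
    (hKT : ∀ r : ℝ,
      AEStronglyMeasurable (duhamelCombination t (Finsupp.single x r)) (spaceTimeMeasure T) →
      ∫⁻ p, ‖duhamelCombination t (Finsupp.single x r) p‖ₑ ^ 2 ∂spaceTimeMeasure T ≤
        ENNReal.ofReal (K * r ^ 2)) :
    ‖h.slice t x‖ₑ ≤ ENNReal.ofReal √K * cameronMartinNorm (P.map ψ) h := by
  set w : EuclideanSpace ℝ (Fin d) := h.slice t x
  set a : Fin d → Set.Icc (0 : ℝ) 1 →₀ ℝ := fun i => Finsupp.single x (‖w‖⁻¹ * w i)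
  have happ : SheetSpace.combination hα hβ t a h = ‖w‖ := by
    rw [SheetSpace.combination_apply]
    simp_rw [a, Finsupp.linearCombination_single]
    have hw : ∀ i, h.slice t x i = w i := fun i => rfl
    simp_rw [hw, smul_eq_mul, mul_assoc, ← sq]
    rw [← Finset.mul_sum, ← EuclideanSpace.real_norm_sq_eq]
    by_cases h0 : ‖w‖ = 0
    · simp [h0]
    · field_simp
  have hvar : evariance (SheetSpace.combination hα hβ t a) (P.map ψ) ≤ ENNReal.ofReal K := by
    rw [hψ.evariance_combination]
    refine (Finset.sum_le_sum fun i _ => hKT _ (hψ.memLp_duhamelCombination i t _).1).trans ?_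
    rw [← ENNReal.ofReal_sum_of_nonneg fun i _ => by positivity, ← Finset.mul_sum]
    refine ENNReal.ofReal_le_ofReal (mul_le_of_le_one_right hK.le ?_)
    simp_rw [mul_pow]
    rw [← Finset.mul_sum, ← EuclideanSpace.real_norm_sq_eq, ← mul_pow]
    exact pow_le_one₀ (by positivity) inv_mul_le_one
  have hcm := ofReal_apply_le_cameronMartinNorm _ hK hvar h
  rwa [happ, ofReal_norm] at hcm

end IsStochasticHeatSheet

/-! ### From total variation to `q`-variation, and the conclusion. -/

lemma ENNReal.sum_rpow_rpow_le_sum {q : ℝ} (hq : 1 ≤ q) {ι : Type*} (s : Finset ι)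
    (f : ι → ℝ≥0∞) : (∑ i ∈ s, f i ^ q) ^ (1 / q) ≤ ∑ i ∈ s, f i := by
  classical
  have hq0 : 0 < q := by linarith
  induction s using Finset.induction_on with
  | empty => simp [hq0]
  | insert i s hi ih =>
    rw [Finset.sum_insert hi, Finset.sum_insert hi]
    calc (f i ^ q + ∑ j ∈ s, f j ^ q) ^ (1 / q)
        = (f i ^ q + ((∑ j ∈ s, f j ^ q) ^ (1 / q)) ^ q) ^ (1 / q) := by
          rw [← ENNReal.rpow_mul, one_div_mul_cancel hq0.ne', ENNReal.rpow_one]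
      _ ≤ f i + (∑ j ∈ s, f j ^ q) ^ (1 / q) := ENNReal.rpow_add_rpow_le_add _ _ hq
      _ ≤ _ := by gcongr

lemma variationNorm_le {V : Type*} [NormedAddCommGroup V] {q : ℝ} (hq : 1 ≤ q)
    {f : Set.Icc (0 : ℝ) 1 → V} {C : ℝ≥0∞}
    (hf : ∀ (u : ℕ → Set.Icc (0 : ℝ) 1) (N : ℕ), Monotone u →
      ∑ j ∈ Finset.range N, ‖f (u (j + 1)) - f (u j)‖ₑ ≤ C) :
    variationNorm q f ≤ C := by
  have hq0 : 0 < q := by linarith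
  rw [variationNorm, one_div, ENNReal.rpow_inv_le_iff hq0]
  refine iSup_le fun p => ?_
  rw [← ENNReal.rpow_inv_le_iff hq0, ← one_div]
  exact (ENNReal.sum_rpow_rpow_le_sum hq _ _).trans (hf p.2.1 p.1 p.2.2)

end

theorem mainTheorem9 (T : ℝ) [Fact (0 < T)] :
    ∃ (c : ℝ) (C : ℝ → ℝ), 0 < c ∧ (∀ q, 0 < C q) ∧
      ∀ (d : ℕ) (α β m : ℝ) [Fact (1 ≤ m)],
        1 / 3 < α → α < 1 / 2 → 0 < β → 1 / 3 < α - 1 / m → 1 / m < β → 4 * β < 1 - 2 * α →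
        ∀ {Ω : Type*} [MeasurableSpace Ω] (P : Measure Ω) [IsProbabilityMeasure P]
          (ξ : Fin d → Lp ℝ 2 (spaceTimeMeasure T) →ₗ[ℝ] Lp ℝ 2 P)
          (ψ : Ω → SheetSpace T α β m d), IsStochasticHeatSheet P ξ ψ →
          ∀ h ∈ cameronMartinSpace (P.map ψ), ∀ t : Set.Icc (0 : ℝ) T,
            (holderNorm (1 / 2) (h.slice t) < ⊤ ∧
              holderNorm (1 / 2) (h.slice t) ≤
                ENNReal.ofReal c * cameronMartinNorm (P.map ψ) h) ∧
            ∀ q : ℝ, 4 / 3 < q → q < 2 →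
              variationNorm q (h.slice t) < ⊤ ∧
                variationNorm q (h.slice t) ≤
                  ENNReal.ofReal (C q) * cameronMartinNorm (P.map ψ) h := by
  obtain ⟨K, hK, hKT⟩ := exists_lintegral_enorm_sq_duhamelKernel_le T
  -- `√K` controls the value at `0` and `1` the Hölder seminorm; the variation constant does not
  -- depend on `q`, since the total variation is already bounded.
  refine ⟨√K + 1, fun _ => 1, by positivity, fun _ => one_pos, ?_⟩
  intro d α β m _ _ _ _ hαm hβ _ Ω _ P _ ξ ψ hψ h hh t
  have hα : 1 / m < α := by linarith
  have hfin : ∀ {a : ℝ≥0∞} {c : ℝ}, a ≤ ENNReal.ofReal c * cameronMartinNorm (P.map ψ) h →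
      a < ⊤ ∧ a ≤ ENNReal.ofReal c * cameronMartinNorm (P.map ψ) h := fun ha =>
    ⟨ha.trans_lt (ENNReal.mul_lt_top ENNReal.ofReal_lt_top hh), ha⟩
  refine ⟨hfin ?_, fun q hq _ => hfin ?_⟩
  · rw [ENNReal.ofReal_add (by positivity) zero_le_one, add_mul]
    refine add_le_add (hψ.enorm_slice_le hα hβ h t 0 hK (hKT t 0)) ?_
    refine iSup_le fun x => iSup_le fun y => iSup_le fun hxy => ?_
    have hpos : 0 < (y : ℝ) - x := sub_pos.2 hxy
    -- The sequence `x, y, y, …` has `u 1 - u 0 = y - x` as its only increment for `N = 1`.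
    have hmono : Monotone fun j : ℕ => if j = 0 then x else y := by
      refine monotone_nat_of_le_succ fun j => ?_
      by_cases hj : j = 0 <;> simp [hj, hxy.le]
    have h1 := hψ.sum_enorm_slice_sub_le hα hβ h t hmono 1 hpos (by simp; linarith)
    simp only [Finset.sum_range_one, zero_add, one_ne_zero, if_false, if_true] at h1
    rw [abs_of_pos hpos, ← Real.sqrt_eq_rpow]
    refine ENNReal.div_le_of_le_mul ?_
    rw [ENNReal.ofReal_one, one_mul, mul_comm]
    exact h1
  · refine variationNorm_le (by linarith) fun u N hu => ?_
    -- Here `v = 1` suffices, because `u N - u 0 ≤ 1`.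
    have h1 := hψ.sum_enorm_slice_sub_le hα hβ h t hu N one_pos
      (by linarith [(u N).2.2, (u 0).2.1])
    simpa using h1
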